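/- There are universal constants $\mathcal C_0>1$ and $\mathcal C_1>\tfrac14$ such that the following holds. Let $A\in\mathbb R^{m\times n}$ have rows of Euclidean norm $1$, let $b\in\mathbb R^m$, $c\in\mathbb R^n$, and let $Q\in\mathbb R^{n\times n}$ (not necessarily symmetric or semidefinite) have spectral norm $\|Q\|_2=1$. Let $S^*=\{x\in\mathbb R^n : Ax\le b,\ \|x\|\le 1\}$ be full-dimensional (its affine hull is $\mathbb R^n$), and let $\mathrm{FULL}(S^*)>0$ be the largest radius of a closed ball contained in $S^*$. Let $0<\varepsilon<0.1$ and $0<\delta<1$, and assume $$d\ \ge\ \frac{\log(m/\delta)}{\mathcal C_0\,\varepsilon^2}\qquad\text{and}\qquad n\ \ge\ \frac{(d+1)\log(2d/\delta)}{\mathcal C_1\,\varepsilon^2}.$$ Let $P$ be a random $d\times n$ matrix with i.i.d. centred Gaussian entries of standard deviation $1/\sqrt n$. Consider the two random problems $$(Q^-_\varepsilon)\quad \min\{u^\top PQP^\top u+(Pc)^\top u : u\in\mathbb R^d,\ AP^\top u\le b,\ \|u\|\le 1-\varepsilon\},$$ $$(Q^+_\varepsilon)\quad \min\{u^\top PQP^\top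 u+(Pc)^\top u : u\in\mathbb R^d,\ AP^\top u\le b+\varepsilon,\ \|u\|\le 1+\varepsilon\},$$ where $b+\varepsilon$ means that $\varepsilon$ is added to every coordinate, and assume that $(Q^-_\varepsilon)$ is feasible almost surely. Then, with probability at least $1-4\delta$, for all optimal solutions $u^-_\varepsilon$ of $(Q^-_\varepsilon)$ and $u^+_\varepsilon$ of $(Q^+_\varepsilon)$, the points $x^\pm_\varepsilon=P^\top u^\pm_\varepsilon$ satisfy $$x_\varepsilon^{+\top}Qx_\varepsilon^{+}+c^\top x_\varepsilon^{+}\ \le\ x_\varepsilon^{-\top}Qx_\varepsilon^{-}+c^\top x_\varepsilon^{-}\ <\ x_\varepsilon^{+\top}Qx_\varepsilon^{+}+c^\top x_\varepsilon^{+}+\frac{\varepsilon}{\mathrm{FULL}(S^*)}\,(36+18\|c\|).$$ -/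

import Mathlib

open MeasureTheory ProbabilityTheory
open scoped NNReal ENNReal Matrix

namespace TrustRegion

/-- The quadratic model `x ↦ xᵀ Q x + cᵀ x` on Euclidean space `ℝᵏ`. -/
def quadModel {k : ℕ} (Q : Matrix (Fin k) (Fin k) ℝ) (c x : EuclideanSpace ℝ (Fin k)) : ℝ :=
  x.ofLp ⬝ᵥ (Q *ᵥ x.ofLp) + c.ofLp ⬝ᵥ x.ofLp

/-- The feasible set `{x ∈ ℝᵏ | A x ≤ b, ‖x‖ ≤ ρ}` (Euclidean norm). -/
def feasibleSet {m k : ℕ} (A : Matrix (Fin m) (Fin k) ℝ) (b : Fin m → ℝ) (ρ : ℝ) :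
    Set (EuclideanSpace ℝ (Fin k)) :=
  {x | (∀ i, (A *ᵥ x.ofLp) i ≤ b i) ∧ ‖x‖ ≤ ρ}

/-- The matrix `M` as a map between Euclidean spaces. -/
def applyMat {k l : ℕ} (M : Matrix (Fin k) (Fin l) ℝ) (x : EuclideanSpace ℝ (Fin l)) :
    EuclideanSpace ℝ (Fin k) :=
  WithLp.toLp 2 (M *ᵥ x.ofLp)

/-- `u` is an optimal solution of `min {f u | u ∈ S}`. -/
def IsOptimal {E : Type*} (f : E → ℝ) (S : Set E) (u : E) : Prop :=
  u ∈ S ∧ ∀ v ∈ S, f u ≤ f v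

/-- The objective `u ↦ uᵀ (P Q Pᵀ) u + (P c)ᵀ u` of the projected problems. -/
def projModel {d n : ℕ} (P : Matrix (Fin d) (Fin n) ℝ) (Q : Matrix (Fin n) (Fin n) ℝ)
    (c : EuclideanSpace ℝ (Fin n)) : EuclideanSpace ℝ (Fin d) → ℝ :=
  quadModel (P * Q * Pᵀ) (applyMat P c)

/-- Feasible set of the shrunk projected problem: `A Pᵀ u ≤ b`, `‖u‖ ≤ 1 - ε`. -/
def projMinus {m n d : ℕ} (A : Matrix (Fin m) (Fin n) ℝ) (b : Fin m → ℝ) (ε : ℝ)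
    (P : Matrix (Fin d) (Fin n) ℝ) : Set (EuclideanSpace ℝ (Fin d)) :=
  feasibleSet (A * Pᵀ) b (1 - ε)

/-- Feasible set of the enlarged projected problem: `A Pᵀ u ≤ b + ε`, `‖u‖ ≤ 1 + ε`. -/
def projPlus {m n d : ℕ} (A : Matrix (Fin m) (Fin n) ℝ) (b : Fin m → ℝ) (ε : ℝ)
    (P : Matrix (Fin d) (Fin n) ℝ) : Set (EuclideanSpace ℝ (Fin d)) :=
  feasibleSet (A * Pᵀ) (fun i => b i + ε) (1 + ε)

/-- The fullness measure: the largest radius of a closed ball contained in `S`. -/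
noncomputable def fullness {k : ℕ} (S : Set (EuclideanSpace ℝ (Fin k))) : ℝ :=
  sSup {r : ℝ | 0 ≤ r ∧ ∃ x, Metric.closedBall x r ⊆ S}

/-- The entries of the random `d × n` matrix `P` are independent centred Gaussians with standard
deviation `1 / √n`, that is, with variance `1 / n`. -/
def IsGaussianMatrix {Ω : Type*} [MeasurableSpace Ω] (μ : Measure Ω) {d n : ℕ}
    (P : Ω → Matrix (Fin d) (Fin n) ℝ) : Prop :=
  (∀ i j, HasLaw (fun ω => P ω i j) (gaussianReal 0 (1 / (n : ℝ≥0))) μ) ∧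
    iIndepFun (fun (ij : Fin d × Fin n) (ω : Ω) => P ω ij.1 ij.2) μ

end TrustRegion

/-! ### Exponential moments of Gaussian quadratic forms. -/

namespace TrustRegion

/-! After projection, little of `Q` survives beyond its trace. Write f(u) = uᵀPQPᵀu + (Pc)ᵀu and τ =
tr Q / n, so |τ| ≤ 1. With high probability, simultaneously for all u, f(u) differs from τ‖u‖² by at
most 6ε‖u‖² + 2ε‖c‖‖u‖. Both problems are therefore close to optimising τ‖u‖², and
`lt_add_of_near_isotropic` compares their values.

Almost sure feasibility forces b ≥ 0 (`IsGaussianMatrix.nonneg_of_ae_nonempty`), hence f(u⁻) ≤ f(0)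
= 0, which suffices if τ ≥ 0. If τ ≤ 0, a feasible w with ‖w‖ = 1 - ε is wanted: τ(1-ε)² exceeds
τ(1+ε)² by at most 4ε. When the fullness exceeds 10ε, w is the normalised projection of a point with
slack 5ε in every linear constraint (`exists_slack_point`, `exists_norm_eq_feasible`). Otherwise
ε/FULL ≥ 1/10 and the claimed gap exceeds a crude bound on |f|. The non-strict inequality is just
inclusion of feasible sets.

The probabilistic input is the Hanson-Wright type bound `lintegral_exp_quadratic_stdGaussian_le`,
applied to Kronecker products acting on the vectorised matrix. Uniformity in u comes not from a net
but from averaging the exponential over a ball (`exists_quadratic_bound_of_lintegral_exp_le`). -/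

lemma exp_neg_le_sqrt_mul_exp {t : ℝ} (ht : |t| ≤ 1 / 4) :
    Real.exp (-t) ≤ √(1 - 2 * t) * Real.exp (2 * t ^ 2) := by
  obtain ⟨h1, h2⟩ := abs_le.1 ht
  -- The square of the claim, with the exponentials gathered on one side.
  have key : 1 ≤ (1 - 2 * t) * Real.exp (2 * t + 4 * t ^ 2) := by
    rcases le_total 0 t with h | h
    · have hq := Real.quadratic_le_exp_of_nonneg (show 0 ≤ 2 * t + 4 * t ^ 2 by positivity)
      have : 1 ≤ (1 - 2 * t) * (1 + (2 * t + 4 * t ^ 2) + (2 * t + 4 * t ^ 2) ^ 2 / 2) := by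
        have : 0 ≤ t ^ 2 * (1 - 4 * t) := mul_nonneg (sq_nonneg t) (by linarith)
        nlinarith [mul_nonneg (sq_nonneg t) h, mul_nonneg this h, mul_nonneg this (sq_nonneg t)]
      exact this.trans (mul_le_mul_of_nonneg_left hq (by linarith))
    -- For t ≤ 0 the linear bound is enough, since (1-2t)(1+2t+4t²) = 1-(2t)³.
    · have hq := Real.add_one_le_exp (2 * t + 4 * t ^ 2)
      have : 1 ≤ (1 - 2 * t) * (2 * t + 4 * t ^ 2 + 1) := by
        nlinarith [mul_nonneg (sq_nonneg t) (neg_nonneg.2 h)]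
      exact this.trans (mul_le_mul_of_nonneg_left hq (by linarith))
  have h3 : Real.exp (-t) = √(Real.exp (-(2 * t))) := by
    rw [← Real.exp_half]; congr 1; ring
  have h4 : Real.exp (2 * t ^ 2) = √(Real.exp (4 * t ^ 2)) := by
    rw [← Real.exp_half]; congr 1; ring
  rw [h3, h4, ← Real.sqrt_mul (by linarith)]
  apply Real.sqrt_le_sqrt
  calc Real.exp (-(2 * t)) = 1 * Real.exp (-(2 * t)) := (one_mul _).symm
    _ ≤ ((1 - 2 * t) * Real.exp (2 * t + 4 * t ^ 2)) * Real.exp (-(2 * t)) := by gcongr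
    _ = _ := by rw [mul_assoc, ← Real.exp_add]; congr 2; ring

/-- The centred square of a standard Gaussian variable is sub-exponential. -/
lemma lintegral_exp_sq_sub_one_gaussianReal_le {t : ℝ} (ht : |t| ≤ 1 / 4) :
    ∫⁻ x, ENNReal.ofReal (Real.exp (t * (x ^ 2 - 1))) ∂(gaussianReal 0 1) ≤
      ENNReal.ofReal (Real.exp (2 * t ^ 2)) := by
  obtain ⟨h1, h2⟩ := abs_le.1 ht
  have hpos : 0 < 1 / 2 - t := by linarith
  have hfun : ∀ x : ℝ, gaussianPDF 0 1 x * ENNReal.ofReal (Real.exp (t * (x ^ 2 - 1))) =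
      ENNReal.ofReal ((√(2 * Real.pi))⁻¹ * Real.exp (-t) * Real.exp (-(1 / 2 - t) * x ^ 2)) := by
    intro x
    rw [gaussianPDF, ← ENNReal.ofReal_mul (gaussianPDFReal_nonneg _ _ _), gaussianPDFReal]
    simp only [NNReal.coe_one, mul_one, sub_zero]
    rw [mul_assoc, mul_assoc, ← Real.exp_add, ← Real.exp_add]
    congr 3
    ring
  rw [gaussianReal_of_var_ne_zero 0 one_ne_zero,
    lintegral_withDensity_eq_lintegral_mul _ (measurable_gaussianPDF 0 1) (by fun_prop)]
  simp only [Pi.mul_apply, hfun]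
  rw [← ofReal_integral_eq_lintegral_ofReal ((integrable_exp_neg_mul_sq hpos).const_mul _)
    (Filter.Eventually.of_forall fun x => by positivity), integral_const_mul, integral_gaussian]
  apply ENNReal.ofReal_le_ofReal
  have h5 : √(Real.pi / (1 / 2 - t)) = √(2 * Real.pi) / √(1 - 2 * t) := by
    rw [← Real.sqrt_div (by positivity)]
    congr 1
    have : (1 - 2 * t) ≠ 0 := by linarith
    field_simp
  have h6 : 0 < √(1 - 2 * t) := Real.sqrt_pos.2 (by linarith)
  have h7 : 0 < √(2 * Real.pi) := by positivity
  rw [h5, show (√(2 * Real.pi))⁻¹ * Real.exp (-t) * (√(2 * Real.pi) / √(1 - 2 * t)) =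
    Real.exp (-t) / √(1 - 2 * t) by field_simp, div_le_iff₀ h6, mul_comm]
  exact exp_neg_le_sqrt_mul_exp ht

variable {ι : Type*} [Fintype ι]

lemma sum_sq_entries_eq_trace (A : Matrix ι ι ℝ) : ∑ i, ∑ j, A i j ^ 2 = (A * Aᵀ).trace := by
  simp [Matrix.trace, Matrix.mul_apply, sq]

/-- In an orthonormal eigenbasis the Gaussian coordinates stay independent and the form becomes Σ
eᵢxᵢ², so the integral factors. Testing `hρ` on eigenvectors gives |t eᵢ| ≤ 1/4, the range of the
one-dimensional bound. -/
lemma lintegral_exp_quadratic_stdGaussian_le_of_isHermitian {A : Matrix ι ι ℝ}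
    (hA : A.IsHermitian) {ρ t : ℝ} (hρ : ∀ v : ι → ℝ, |v ⬝ᵥ A *ᵥ v| ≤ ρ * (v ⬝ᵥ v))
    (ht : |t| * ρ ≤ 1 / 4) :
    ∫⁻ x, ENNReal.ofReal (Real.exp (t * (x.ofLp ⬝ᵥ A *ᵥ x.ofLp - A.trace)))
      ∂(stdGaussian (EuclideanSpace ℝ ι)) ≤
      ENNReal.ofReal (Real.exp (2 * t ^ 2 * ∑ i, ∑ j, A i j ^ 2)) := by
  classical
  set b := hA.eigenvectorBasis with hb
  set e := hA.eigenvalues with he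
  have hbb : ∀ i j, (b i).ofLp ⬝ᵥ (b j).ofLp = if i = j then 1 else 0 := by
    intro i j
    have := orthonormal_iff_ite.1 b.orthonormal j i
    rw [EuclideanSpace.inner_eq_star_dotProduct] at this
    simpa [eq_comm] using this
  have hAb : ∀ j, A *ᵥ (b j).ofLp = e j • (b j).ofLp := hA.mulVec_eigenvectorBasis
  have hquad : ∀ x : ι → ℝ, (∑ i, x i • b i).ofLp ⬝ᵥ A *ᵥ (∑ i, x i • b i).ofLp =
      ∑ i, e i * x i ^ 2 := by
    intro x
    simp only [WithLp.ofLp_sum, WithLp.ofLp_smul, Matrix.mulVec_sum, Matrix.mulVec_smul, hAb,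
      sum_dotProduct, dotProduct_sum, smul_dotProduct, dotProduct_smul, hbb, smul_eq_mul]
    simp
    exact Finset.sum_congr rfl fun i _ => by ring
  have htr : A.trace = ∑ i, e i := by simpa using hA.trace_eq_sum_eigenvalues
  have hsq : ∑ i, ∑ j, A i j ^ 2 = ∑ i, e i ^ 2 := by
    have h1 : Aᵀ = A := by simpa [Matrix.IsHermitian] using hA
    have h2 := hA.spectral_theorem
    rw [Unitary.conjStarAlgAut_apply] at h2
    rw [sum_sq_entries_eq_trace, h1]
    set U := (hA.eigenvectorUnitary : Matrix ι ι ℝ)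
    have hU : star U * U = 1 := by simp [U]
    set D := Matrix.diagonal (((↑) : ℝ → ℝ) ∘ hA.eigenvalues)
    have : (A * A).trace = (D * D).trace := by
      rw [h2]
      calc (U * D * star U * (U * D * star U)).trace
          = (U * D * (star U * U) * D * star U).trace := by simp only [mul_assoc]
        _ = _ := by
          rw [hU, mul_one, Matrix.trace_mul_comm, ← mul_assoc, ← mul_assoc, hU, one_mul]
    rw [this]
    simp [D, Matrix.diagonal_mul_diagonal, Matrix.trace_diagonal, sq, he]
  have hle : ∀ i, |t * e i| ≤ 1 / 4 := by
    intro i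
    have := hρ (b i).ofLp
    rw [hAb, dotProduct_smul, hbb, if_pos rfl] at this
    rw [abs_mul]
    refine le_trans (mul_le_mul_of_nonneg_left ?_ (abs_nonneg t)) ht
    simpa using this
  rw [stdGaussian_eq_map_pi_orthonormalBasis b, lintegral_map (by fun_prop) (by fun_prop)]
  simp only [hquad, htr, hsq]
  have hprod : ∀ x : ι → ℝ,
      ENNReal.ofReal (Real.exp (t * (∑ i, e i * x i ^ 2 - ∑ i, e i))) =
      ∏ i, ENNReal.ofReal (Real.exp (t * e i * (x i ^ 2 - 1))) := by
    intro x
    rw [← ENNReal.ofReal_prod_of_nonneg fun i _ => (Real.exp_pos _).le, ← Real.exp_sum,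
      ← Finset.sum_sub_distrib, Finset.mul_sum]
    congr 2
    exact Finset.sum_congr rfl fun i _ => by ring
  simp only [hprod]
  have hind : iIndepFun (fun (i : ι) (x : ι → ℝ) =>
      ENNReal.ofReal (Real.exp (t * e i * (x i ^ 2 - 1))))
      (Measure.pi fun _ : ι => gaussianReal 0 1) :=
    iIndepFun_pi (X := fun i (y : ℝ) => ENNReal.ofReal (Real.exp (t * e i * (y ^ 2 - 1))))
      (fun i => by fun_prop)
  rw [lintegral_prod_eq_prod_lintegral_of_indepFun _ _ hind (fun i => by fun_prop), Finset.mul_sum,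
    Real.exp_sum, ENNReal.ofReal_prod_of_nonneg fun i _ => (Real.exp_pos _).le]
  refine Finset.prod_le_prod' fun i _ => ?_
  have hev := (measurePreserving_eval (fun _ : ι => gaussianReal 0 1) i).lintegral_comp
    (f := fun y => ENNReal.ofReal (Real.exp (t * e i * (y ^ 2 - 1)))) (by fun_prop)
  refine (hev.trans_le (lintegral_exp_sq_sub_one_gaussianReal_le (hle i))).trans_eq ?_
  congr 2
  ring

/-- Exponential moments of a quadratic form (a Hanson-Wright type bound) in a standard Gaussian
vector. -/
lemma lintegral_exp_quadratic_stdGaussian_le (B : Matrix ι ι ℝ) {ρ t : ℝ}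
    (hρ : ∀ v : ι → ℝ, |v ⬝ᵥ B *ᵥ v| ≤ ρ * (v ⬝ᵥ v)) (ht : |t| * ρ ≤ 1 / 4) :
    ∫⁻ x, ENNReal.ofReal (Real.exp (t * (x.ofLp ⬝ᵥ B *ᵥ x.ofLp - B.trace)))
      ∂(stdGaussian (EuclideanSpace ℝ ι)) ≤
      ENNReal.ofReal (Real.exp (2 * t ^ 2 * ∑ i, ∑ j, B i j ^ 2)) := by
  -- Symmetrising keeps the quadratic form and the trace, and does not increase the Frobenius norm.
  set A : Matrix ι ι ℝ := (1 / 2 : ℝ) • (B + Bᵀ) with hA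
  have hAq : ∀ v : ι → ℝ, v ⬝ᵥ A *ᵥ v = v ⬝ᵥ B *ᵥ v := by
    intro v
    have : v ⬝ᵥ Bᵀ *ᵥ v = v ⬝ᵥ B *ᵥ v := by
      rw [Matrix.mulVec_transpose, dotProduct_comm, Matrix.dotProduct_mulVec]
    rw [hA, Matrix.smul_mulVec, Matrix.add_mulVec, dotProduct_smul, dotProduct_add, this,
      smul_eq_mul]
    ring
  have hAt : A.trace = B.trace := by
    rw [hA, Matrix.trace_smul, Matrix.trace_add, Matrix.trace_transpose, smul_eq_mul]
    ring
  have hAH : A.IsHermitian := by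
    rw [Matrix.IsHermitian, Matrix.conjTranspose_eq_transpose_of_trivial, hA,
      Matrix.transpose_smul, Matrix.transpose_add, Matrix.transpose_transpose, add_comm]
  have hAs : ∑ i, ∑ j, A i j ^ 2 ≤ ∑ i, ∑ j, B i j ^ 2 := by
    have h1 : ∑ i, ∑ j, B j i ^ 2 = ∑ i, ∑ j, B i j ^ 2 := Finset.sum_comm
    calc ∑ i, ∑ j, A i j ^ 2 ≤ ∑ i, ∑ j, (B i j ^ 2 / 2 + B j i ^ 2 / 2) := by
          refine Finset.sum_le_sum fun i _ => Finset.sum_le_sum fun j _ => ?_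
          simp only [hA, Matrix.smul_apply, Matrix.add_apply, Matrix.transpose_apply, smul_eq_mul]
          nlinarith [sq_nonneg (B i j - B j i)]
      _ = _ := by
          simp only [Finset.sum_add_distrib, ← Finset.sum_div, h1]
          ring
  have := lintegral_exp_quadratic_stdGaussian_le_of_isHermitian hAH (ρ := ρ) (t := t)
    (by simpa only [hAq] using hρ) ht
  simp only [hAq, hAt] at this
  refine this.trans (ENNReal.ofReal_le_ofReal (Real.exp_le_exp.2 ?_))
  exact mul_le_mul_of_nonneg_left hAs (by positivity)

end TrustRegion

/-! ### From an average over a ball to a uniform bound. -/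

namespace TrustRegion

lemma exp_abs_le_exp_add_exp_neg (a : ℝ) : Real.exp |a| ≤ Real.exp a + Real.exp (-a) := by
  rcases abs_cases a with h | h <;> rw [h.1] <;> linarith [Real.exp_pos a, Real.exp_pos (-a)]

/-- A quadratic form is bounded by the logarithm of the average over a ball of its two-sided
exponential. -/
lemma exists_quadratic_bound_of_lintegral_exp_le {d : ℕ} (hd : 0 < d)
    {q : EuclideanSpace ℝ (Fin d) → ℝ} (hq : Continuous q)
    (hpar : ∀ v h, q (v + h) + q (v - h) = 2 * q v + 2 * q h)
    (hhom : ∀ (t : ℝ) v, q (t • v) = t ^ 2 * q v) {C : ℝ} (hC : 0 ≤ C)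
    (hint : ∫⁻ w in Metric.ball (0 : EuclideanSpace ℝ (Fin d)) (3 / 2),
      ENNReal.ofReal (Real.exp (q w) + Real.exp (-q w)) ≤
        ENNReal.ofReal C * volume (Metric.ball (0 : EuclideanSpace ℝ (Fin d)) (1 / 2))) :
    ∃ S, Real.exp (3 / 4 * S) ≤ 2 * C ∧ ∀ v, |q v| ≤ S * ‖v‖ ^ 2 := by
  have : Nonempty (Fin d) := ⟨⟨0, hd⟩⟩
  obtain ⟨v, hv, hmax⟩ := (isCompact_sphere (0 : EuclideanSpace ℝ (Fin d)) 1).exists_isMaxOn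
    (NormedSpace.sphere_nonempty.2 zero_le_one) hq.abs.continuousOn
  have hv1 : ‖v‖ = 1 := by simpa using hv
  set S := |q v| with hS
  have hS0 : 0 ≤ S := abs_nonneg _
  have hbound : ∀ u, |q u| ≤ S * ‖u‖ ^ 2 := by
    intro u
    rcases eq_or_ne u 0 with rfl | hu
    · have := hhom 0 0
      simp at this
      simp [this]
    · have hu' : ‖u‖ ≠ 0 := norm_ne_zero_iff.2 hu
      have h1 : ‖u‖⁻¹ • u ∈ Metric.sphere (0 : EuclideanSpace ℝ (Fin d)) 1 := by
        simp [norm_smul, hu']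
      have h2 : |q (‖u‖⁻¹ • u)| ≤ S := hmax h1
      rw [hhom, abs_mul, abs_of_nonneg (sq_nonneg _), inv_pow, inv_mul_le_iff₀ (by positivity)] at h2
      linarith
  refine ⟨S, ?_, hbound⟩
  set F : EuclideanSpace ℝ (Fin d) → ℝ≥0∞ :=
    fun w => ENNReal.ofReal (Real.exp (q w) + Real.exp (-q w)) with hF
  have hFm : Measurable F := by
    have := hq.measurable
    fun_prop
  set B := Metric.ball (0 : EuclideanSpace ℝ (Fin d)) (1 / 2) with hB
  -- With v a maximiser of |q| on the sphere, 2q(v) = q(v+h) + q(v-h) - 2q(h) and |q(h)| ≤ S/4, so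
  -- one of |q(v±h)| is at least 3S/4. Both points lie in the ball of radius 3/2.
  have hpt : ∀ h ∈ B, ENNReal.ofReal (Real.exp (3 / 4 * S)) ≤ F (v + h) + F (v - h) := by
    intro h hh
    have hh' : ‖h‖ < 1 / 2 := by simpa [hB] using hh
    have hh2 : ‖h‖ ^ 2 ≤ 1 / 4 := by nlinarith [norm_nonneg h]
    have hqh : |q h| ≤ S / 4 := (hbound h).trans (by nlinarith)
    have hor : 3 / 4 * S ≤ |q (v + h)| ∨ 3 / 4 * S ≤ |q (v - h)| := by
      by_contra! hcon
      have h1 := hpar v h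
      have h2 : |2 * q v| ≤ |q (v + h)| + |q (v - h)| + 2 * |q h| := by
        rw [show 2 * q v = q (v + h) + q (v - h) - 2 * q h by linarith]
        refine (abs_sub _ _).trans ?_
        rw [abs_mul, abs_two]
        gcongr
        exact abs_add_le _ _
      rw [abs_mul, abs_two] at h2
      linarith
    have hFle : ∀ w, 3 / 4 * S ≤ |q w| → ENNReal.ofReal (Real.exp (3 / 4 * S)) ≤ F w :=
      fun w hw => ENNReal.ofReal_le_ofReal
        ((Real.exp_le_exp.2 hw).trans (exp_abs_le_exp_add_exp_neg _))
    rcases hor with h1 | h1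
    · exact (hFle _ h1).trans le_self_add
    · exact (hFle _ h1).trans le_add_self
  have hplus : ∫⁻ h in B, F (v + h) ≤ ∫⁻ w in Metric.ball 0 (3 / 2), F w := by
    rw [← lintegral_indicator measurableSet_ball, ← lintegral_indicator measurableSet_ball,
      ← lintegral_add_left_eq_self (Set.indicator (Metric.ball 0 (3 / 2)) F) v]
    refine lintegral_mono fun h => ?_
    refine Set.indicator_apply_le' (fun hh => ?_) fun _ => zero_le
    have hh' : ‖h‖ < 1 / 2 := by simpa [hB] using hh
    rw [Set.indicator_of_mem]
    rw [mem_ball_zero_iff]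
    linarith [norm_add_le v h]
  have hminus : ∫⁻ h in B, F (v - h) ≤ ∫⁻ w in Metric.ball 0 (3 / 2), F w := by
    rw [← lintegral_indicator measurableSet_ball, ← lintegral_indicator measurableSet_ball,
      ← lintegral_sub_left_eq_self (Set.indicator (Metric.ball 0 (3 / 2)) F) v]
    refine lintegral_mono fun h => ?_
    refine Set.indicator_apply_le' (fun hh => ?_) fun _ => zero_le
    have hh' : ‖h‖ < 1 / 2 := by simpa [hB] using hh
    rw [Set.indicator_of_mem]
    rw [mem_ball_zero_iff]
    linarith [norm_sub_le v h]
  have hfin : volume B ≠ ⊤ := measure_ball_lt_top.ne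
  have hpos : volume B ≠ 0 := (Metric.measure_ball_pos volume 0 (by norm_num)).ne'
  have hmain : ENNReal.ofReal (Real.exp (3 / 4 * S)) * volume B ≤
      ENNReal.ofReal (2 * C) * volume B := by
    calc ENNReal.ofReal (Real.exp (3 / 4 * S)) * volume B
        = ∫⁻ _ in B, ENNReal.ofReal (Real.exp (3 / 4 * S)) := by rw [setLIntegral_const]
      _ ≤ ∫⁻ h in B, (F (v + h) + F (v - h)) := setLIntegral_mono' measurableSet_ball hpt
      _ = (∫⁻ h in B, F (v + h)) + ∫⁻ h in B, F (v - h) := lintegral_add_left (by fun_prop) _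
      _ ≤ ENNReal.ofReal C * volume B + ENNReal.ofReal C * volume B :=
          add_le_add (hplus.trans hint) (hminus.trans hint)
      _ = ENNReal.ofReal (2 * C) * volume B := by
          rw [← add_mul, ← ENNReal.ofReal_add hC hC, two_mul]
  have := (ENNReal.mul_le_mul_iff_left hpos hfin).1 hmain
  exact (ENNReal.ofReal_le_ofReal_iff (by positivity)).1 this

end TrustRegion

/-! ### Gaussian matrices as Gaussian vectors: Kronecker products and tail bounds. -/

namespace TrustRegion

variable {d n : ℕ}

/-- A vector indexed by pairs, seen as a matrix. -/
def toMatrix (X : EuclideanSpace ℝ (Fin d × Fin n)) : Matrix (Fin d) (Fin n) ℝ :=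
  Matrix.of fun k j => X.ofLp (k, j)

lemma dotProduct_sq_le {ι : Type*} [Fintype ι] (v w : ι → ℝ) :
    (v ⬝ᵥ w) ^ 2 ≤ (v ⬝ᵥ v) * (w ⬝ᵥ w) := by
  have := Finset.sum_mul_sq_le_sq_mul_sq Finset.univ v w
  simpa only [dotProduct, sq] using this

lemma dotProduct_self_nonneg_real {ι : Type*} [Fintype ι] (v : ι → ℝ) : 0 ≤ v ⬝ᵥ v :=
  Finset.sum_nonneg fun i _ => mul_self_nonneg (v i)

lemma dotProduct_self_ofLp {ι : Type*} [Fintype ι] (u : EuclideanSpace ℝ ι) :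
    u.ofLp ⬝ᵥ u.ofLp = ‖u‖ ^ 2 := by
  rw [EuclideanSpace.real_norm_sq_eq]
  simp [dotProduct, sq]

lemma dotProduct_kronecker_mulVec (M : Matrix (Fin d) (Fin d) ℝ) (Q : Matrix (Fin n) (Fin n) ℝ)
    (v : Fin d × Fin n → ℝ) :
    v ⬝ᵥ (Matrix.kroneckerMap (· * ·) M Q) *ᵥ v =
      ∑ k, ∑ l, M k l * ((fun j => v (k, j)) ⬝ᵥ Q *ᵥ (fun j => v (l, j))) := by
  simp only [dotProduct, Matrix.mulVec, Fintype.sum_prod_type, Matrix.kroneckerMap_apply,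
    Finset.mul_sum]
  refine Finset.sum_congr rfl fun k _ => ?_
  rw [Finset.sum_comm]
  refine Finset.sum_congr rfl fun l _ => Finset.sum_congr rfl fun i _ =>
    Finset.sum_congr rfl fun j _ => ?_
  ring

lemma sum_sq_kronecker (M : Matrix (Fin d) (Fin d) ℝ) (Q : Matrix (Fin n) (Fin n) ℝ) :
    ∑ p, ∑ q, (Matrix.kroneckerMap (· * ·) M Q) p q ^ 2 =
      (∑ k, ∑ l, M k l ^ 2) * ∑ i, ∑ j, Q i j ^ 2 := by
  simp only [Fintype.sum_prod_type, Matrix.kroneckerMap_apply, Finset.sum_mul_sum, mul_pow]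

/-- Exponential moments of `(Xᵀ w)ᵀ Q (Xᵀ w)` for a standard Gaussian matrix `X`. -/
lemma lintegral_exp_transpose_quadratic_le {Q : Matrix (Fin n) (Fin n) ℝ}
    (hQ : ∀ v : Fin n → ℝ, |v ⬝ᵥ Q *ᵥ v| ≤ v ⬝ᵥ v) (w : Fin d → ℝ) {t : ℝ}
    (ht : |t| * (w ⬝ᵥ w) ≤ 1 / 4) :
    ∫⁻ X, ENNReal.ofReal (Real.exp (t * ((toMatrix X)ᵀ *ᵥ w ⬝ᵥ Q *ᵥ ((toMatrix X)ᵀ *ᵥ w) -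
        (w ⬝ᵥ w) * Q.trace))) ∂(stdGaussian (EuclideanSpace ℝ (Fin d × Fin n))) ≤
      ENNReal.ofReal (Real.exp (2 * t ^ 2 * ((w ⬝ᵥ w) ^ 2 * ∑ i, ∑ j, Q i j ^ 2))) := by
  -- On the vectorised X the form is wwᵀ ⊗ Q; its operator size is at most ‖w‖² and its Frobenius
  -- norm is ‖w‖²‖Q‖_F.
  set B := Matrix.kroneckerMap (· * ·) (Matrix.vecMulVec w w) Q with hB
  have hquad : ∀ v : Fin d × Fin n → ℝ, v ⬝ᵥ B *ᵥ v =
      (Matrix.of fun k j => v (k, j))ᵀ *ᵥ w ⬝ᵥ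
        Q *ᵥ ((Matrix.of fun k j => v (k, j))ᵀ *ᵥ w) := by
    intro v
    have hy : (Matrix.of fun k j => v (k, j))ᵀ *ᵥ w = ∑ k, w k • fun j => v (k, j) := by
      ext j
      simp [Matrix.mulVec, dotProduct, mul_comm]
    rw [hB, dotProduct_kronecker_mulVec, hy]
    simp only [Matrix.mulVec_sum, Matrix.mulVec_smul, sum_dotProduct, dotProduct_sum,
      smul_dotProduct, dotProduct_smul, smul_eq_mul, Matrix.vecMulVec_apply,
      Finset.mul_sum]
    rw [Finset.sum_comm]
    refine Finset.sum_congr rfl fun k _ => Finset.sum_congr rfl fun l _ => ?_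
    ring
  have hρ : ∀ v : Fin d × Fin n → ℝ, |v ⬝ᵥ B *ᵥ v| ≤ (w ⬝ᵥ w) * (v ⬝ᵥ v) := by
    intro v
    rw [hquad]
    refine (hQ _).trans ?_
    have hv : v ⬝ᵥ v = ∑ j, ((fun k => v (k, j)) ⬝ᵥ (fun k => v (k, j))) := by
      simp only [dotProduct, Fintype.sum_prod_type]
      rw [Finset.sum_comm]
    rw [hv, Finset.mul_sum]
    refine Finset.sum_le_sum fun j _ => ?_
    have := dotProduct_sq_le (fun k => v (k, j)) w
    rw [← sq]
    refine this.trans_eq (mul_comm _ _)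
  have htr : B.trace = (w ⬝ᵥ w) * Q.trace := by
    rw [hB]
    simp only [Matrix.trace, Matrix.diag, Matrix.kroneckerMap_apply, Fintype.sum_prod_type,
      Matrix.vecMulVec_apply, dotProduct, Finset.sum_mul_sum]
  have hF : ∑ p, ∑ q, B p q ^ 2 = (w ⬝ᵥ w) ^ 2 * ∑ i, ∑ j, Q i j ^ 2 := by
    rw [hB, sum_sq_kronecker]
    congr 1
    simp only [Matrix.vecMulVec_apply, dotProduct, sq, Finset.sum_mul_sum]
    refine Finset.sum_congr rfl fun k _ => Finset.sum_congr rfl fun l _ => ?_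
    ring
  have := lintegral_exp_quadratic_stdGaussian_le B hρ ht
  rw [hF, htr] at this
  simp only [hquad] at this
  exact this

/-- Exponential moments of `(X a)ᵀ (X y)` for a standard Gaussian matrix `X`. -/
lemma lintegral_exp_mulVec_dotProduct_mulVec_le {a y : Fin n → ℝ} (ha : a ⬝ᵥ a ≤ 1)
    (hy : y ⬝ᵥ y ≤ 1) {t : ℝ} (ht : |t| ≤ 1 / 4) :
    ∫⁻ X, ENNReal.ofReal (Real.exp (t * ((toMatrix X) *ᵥ a ⬝ᵥ (toMatrix X) *ᵥ y -
        d * (a ⬝ᵥ y)))) ∂(stdGaussian (EuclideanSpace ℝ (Fin d × Fin n))) ≤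
      ENNReal.ofReal (Real.exp (2 * t ^ 2 * d)) := by
  -- Here the form is I ⊗ ayᵀ: one independent rank-one block per row of X.
  set B := Matrix.kroneckerMap (· * ·) (1 : Matrix (Fin d) (Fin d) ℝ) (Matrix.vecMulVec a y)
    with hB
  have hrow : ∀ v : Fin d × Fin n → ℝ, v ⬝ᵥ B *ᵥ v =
      ∑ k, ((fun j => v (k, j)) ⬝ᵥ a) * ((fun j => v (k, j)) ⬝ᵥ y) := by
    intro v
    rw [hB, dotProduct_kronecker_mulVec]
    refine Finset.sum_congr rfl fun k _ => ?_
    simp only [Matrix.one_apply, ite_mul, one_mul, zero_mul, Finset.sum_ite_eq, Finset.mem_univ,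
      if_true, Matrix.vecMulVec_mulVec]
    simp [dotProduct_smul, dotProduct_comm y, mul_comm]
  have hquad : ∀ v : Fin d × Fin n → ℝ, v ⬝ᵥ B *ᵥ v =
      (Matrix.of fun k j => v (k, j)) *ᵥ a ⬝ᵥ (Matrix.of fun k j => v (k, j)) *ᵥ y := by
    intro v
    rw [hrow]
    rfl
  have hρ : ∀ v : Fin d × Fin n → ℝ, |v ⬝ᵥ B *ᵥ v| ≤ 1 * (v ⬝ᵥ v) := by
    intro v
    rw [hrow, one_mul, show v ⬝ᵥ v = ∑ k, ((fun j => v (k, j)) ⬝ᵥ (fun j => v (k, j))) by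
      simp only [dotProduct, Fintype.sum_prod_type]]
    refine (Finset.abs_sum_le_sum_abs _ _).trans (Finset.sum_le_sum fun k _ => ?_)
    set z : Fin n → ℝ := fun j => v (k, j)
    have hz := dotProduct_self_nonneg_real z
    have h1 : (z ⬝ᵥ a) ^ 2 ≤ z ⬝ᵥ z := (dotProduct_sq_le z a).trans (by nlinarith)
    have h2 : (z ⬝ᵥ y) ^ 2 ≤ z ⬝ᵥ z := (dotProduct_sq_le z y).trans (by nlinarith)
    rw [abs_le]
    constructor <;> nlinarith [sq_nonneg (z ⬝ᵥ a - z ⬝ᵥ y), sq_nonneg (z ⬝ᵥ a + z ⬝ᵥ y)]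
  have htr : B.trace = d * (a ⬝ᵥ y) := by
    rw [hB]
    simp [Matrix.trace, Matrix.diag, Matrix.kroneckerMap_apply, Fintype.sum_prod_type,
      Matrix.vecMulVec_apply, dotProduct]
  have hF : ∑ p, ∑ q, B p q ^ 2 ≤ d := by
    rw [hB, sum_sq_kronecker]
    have h1 : ∑ k, ∑ l, (1 : Matrix (Fin d) (Fin d) ℝ) k l ^ 2 = d := by
      simp [Matrix.one_apply]
    have h2 : ∑ i, ∑ j, Matrix.vecMulVec a y i j ^ 2 = (a ⬝ᵥ a) * (y ⬝ᵥ y) := by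
      simp only [Matrix.vecMulVec_apply, dotProduct, Finset.sum_mul_sum]
      refine Finset.sum_congr rfl fun k _ => Finset.sum_congr rfl fun l _ => ?_
      ring
    rw [h1, h2]
    have : (a ⬝ᵥ a) * (y ⬝ᵥ y) ≤ 1 := mul_le_one₀ ha (dotProduct_self_nonneg_real y) hy
    nlinarith [Nat.cast_nonneg (α := ℝ) d]
  have := lintegral_exp_quadratic_stdGaussian_le B hρ (t := t) (by linarith)
  rw [htr] at this
  simp only [hquad] at this
  refine this.trans (ENNReal.ofReal_le_ofReal (Real.exp_le_exp.2 ?_))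
  exact mul_le_mul_of_nonneg_left hF (by positivity)

/-- Chernoff's argument: Markov's inequality for the exponential. -/
lemma measure_add_le_le_of_lintegral_exp_le {Ω : Type*} [MeasurableSpace Ω] {μ : Measure Ω}
    {Y : Ω → ℝ} (hY : Measurable Y) {K : ℝ}
    (h : ∫⁻ ω, ENNReal.ofReal (Real.exp (Y ω)) ∂μ ≤ ENNReal.ofReal (Real.exp K)) (s : ℝ) :
    μ {ω | K + s ≤ Y ω} ≤ ENNReal.ofReal (Real.exp (-s)) := by
  have h1 := meas_ge_le_lintegral_div (μ := μ) (f := fun ω => ENNReal.ofReal (Real.exp (Y ω)))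
    (by fun_prop) (ε := ENNReal.ofReal (Real.exp (K + s)))
    (by simp [Real.exp_pos]) ENNReal.ofReal_ne_top
  have h2 : {ω | K + s ≤ Y ω} =
      {ω | ENNReal.ofReal (Real.exp (K + s)) ≤ ENNReal.ofReal (Real.exp (Y ω))} := by
    ext ω
    simp [ENNReal.ofReal_le_ofReal_iff (Real.exp_pos _).le]
  rw [h2]
  refine h1.trans ((ENNReal.div_le_div_right h _).trans_eq ?_)
  rw [← ENNReal.ofReal_div_of_pos (Real.exp_pos _), ← Real.exp_sub]
  congr 2
  ring

lemma continuous_toMatrix_apply (k : Fin d) (j : Fin n) :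
    Continuous fun X : EuclideanSpace ℝ (Fin d × Fin n) => toMatrix X k j := by
  simp only [toMatrix, Matrix.of_apply]
  fun_prop

lemma continuous_toMatrix :
    Continuous (toMatrix : EuclideanSpace ℝ (Fin d × Fin n) → Matrix (Fin d) (Fin n) ℝ) :=
  continuous_pi fun k => continuous_pi fun j => continuous_toMatrix_apply k j

lemma measurable_mulVec_dotProduct_mulVec (a y : Fin n → ℝ) :
    Measurable fun X : EuclideanSpace ℝ (Fin d × Fin n) =>
      (toMatrix X) *ᵥ a ⬝ᵥ (toMatrix X) *ᵥ y :=
  ((continuous_toMatrix.matrix_mulVec continuous_const).dotProduct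
    (continuous_toMatrix.matrix_mulVec continuous_const)).measurable

/-- Tail bound for `(X a)ᵀ (X y)` with a standard Gaussian matrix `X`. -/
lemma measure_mulVec_dotProduct_mulVec_tail_le {a y : Fin n → ℝ} (ha : a ⬝ᵥ a ≤ 1)
    (hy : y ⬝ᵥ y ≤ 1) {t : ℝ} (ht : |t| ≤ 1 / 4) (s : ℝ) :
    stdGaussian (EuclideanSpace ℝ (Fin d × Fin n))
      {X | 2 * t ^ 2 * d + s ≤ t * ((toMatrix X) *ᵥ a ⬝ᵥ (toMatrix X) *ᵥ y - d * (a ⬝ᵥ y))} ≤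
      ENNReal.ofReal (Real.exp (-s)) :=
  measure_add_le_le_of_lintegral_exp_le
    (((measurable_mulVec_dotProduct_mulVec a y).sub_const _).const_mul t)
    (lintegral_exp_mulVec_dotProduct_mulVec_le ha hy ht) s

end TrustRegion

/-! ### The concentration events. -/

namespace TrustRegion

variable {d n : ℕ}

/-- The right side is (2d/δ)^(d+1), with base at least 8. On the left, 3^d is the volume ratio of
the balls of radii 3/2 and 1/2, 1/δ comes from Markov, and 4 from two signs times two translates. -/
lemma four_mul_three_pow_div_le {d : ℕ} (hd : 0 < d) {δ : ℝ} (hδ : 0 < δ) (hδ4 : δ < 1 / 4) :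
    4 * 3 ^ d / δ ≤ Real.exp ((d + 1) * Real.log (2 * d / δ)) := by
  have hd1 : (1 : ℝ) ≤ d := by exact_mod_cast hd
  have h1 : 2 / δ ≤ 2 * d / δ := by gcongr; linarith
  have h8 : 8 ≤ 2 / δ := by rw [le_div_iff₀ hδ]; linarith
  have h2 : (0 : ℝ) < 2 * d / δ := by positivity
  have h3 : Real.exp ((d + 1) * Real.log (2 * d / δ)) = (2 * d / δ) ^ (d + 1) := by
    rw [← Real.exp_log (pow_pos h2 (d + 1)), Real.log_pow]
    push_cast
    rfl
  have h4 : (2 : ℝ) * 3 ^ d ≤ 8 ^ d := by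
    obtain ⟨k, rfl⟩ : ∃ k, d = k + 1 := ⟨d - 1, by omega⟩
    have : (3 : ℝ) ^ k ≤ 8 ^ k := by gcongr; norm_num
    rw [pow_succ, pow_succ]
    nlinarith [pow_pos (show (0 : ℝ) < 8 by norm_num) k]
  calc 4 * 3 ^ d / δ = 2 * 3 ^ d * (2 / δ) := by ring
    _ ≤ (2 * d / δ) ^ d * (2 * d / δ) := by
        gcongr
        exact h4.trans (by gcongr; linarith)
    _ = _ := by rw [h3, pow_succ]

/-- With high probability `u ↦ (Xᵀ u)ᵀ Q (Xᵀ u)` is uniformly close to a multiple of `‖u‖²`. -/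
lemma exists_measurableSet_quadratic_concentration {Q : Matrix (Fin n) (Fin n) ℝ}
    (hQ : ∀ v : Fin n → ℝ, |v ⬝ᵥ Q *ᵥ v| ≤ v ⬝ᵥ v) (hQF : ∑ i, ∑ j, Q i j ^ 2 ≤ n)
    (hd : 0 < d) {ε δ : ℝ} (hε : 0 < ε) (hε1 : ε < 1 / 10) (hδ : 0 < δ) (hδ4 : δ < 1 / 4)
    (hn : (d + 1) * Real.log (2 * d / δ) ≤ n * ε ^ 2 / 2) :
    ∃ G : Set (EuclideanSpace ℝ (Fin d × Fin n)), MeasurableSet G ∧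
      stdGaussian (EuclideanSpace ℝ (Fin d × Fin n)) Gᶜ ≤ ENNReal.ofReal δ ∧
      ∀ X ∈ G, ∀ u : EuclideanSpace ℝ (Fin d),
        |(toMatrix X)ᵀ *ᵥ u.ofLp ⬝ᵥ Q *ᵥ ((toMatrix X)ᵀ *ᵥ u.ofLp) - ‖u‖ ^ 2 * Q.trace| ≤
          6 * ε * n * ‖u‖ ^ 2 := by
  set γ := stdGaussian (EuclideanSpace ℝ (Fin d × Fin n)) with hγ
  -- On the ball ‖u‖² ≤ 9/4, and this choice makes the moment exponent 2t²(9/4)²n equal to nε²/2.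
  set t : ℝ := 2 / 9 * ε with ht
  have ht0 : 0 < t := by positivity
  set q : EuclideanSpace ℝ (Fin d × Fin n) → EuclideanSpace ℝ (Fin d) → ℝ := fun X u =>
    t * ((toMatrix X)ᵀ *ᵥ u.ofLp ⬝ᵥ Q *ᵥ ((toMatrix X)ᵀ *ᵥ u.ofLp) -
      (u.ofLp ⬝ᵥ u.ofLp) * Q.trace) with hq
  have hqc : Continuous fun p : EuclideanSpace ℝ (Fin d × Fin n) × EuclideanSpace ℝ (Fin d) =>
      q p.1 p.2 := by
    have h1 : Continuous fun p : EuclideanSpace ℝ (Fin d × Fin n) × EuclideanSpace ℝ (Fin d) =>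
        (toMatrix p.1)ᵀ *ᵥ p.2.ofLp :=
      ((continuous_toMatrix.comp continuous_fst).matrix_transpose).matrix_mulVec
        ((PiLp.continuous_ofLp 2 _).comp continuous_snd)
    have h2 : Continuous fun p : EuclideanSpace ℝ (Fin d × Fin n) × EuclideanSpace ℝ (Fin d) =>
        p.2.ofLp := (PiLp.continuous_ofLp 2 _).comp continuous_snd
    exact continuous_const.mul ((h1.dotProduct (continuous_const.matrix_mulVec h1)).sub
      ((h2.dotProduct h2).mul continuous_const))
  set F : EuclideanSpace ℝ (Fin d × Fin n) → EuclideanSpace ℝ (Fin d) → ℝ≥0∞ := fun X u =>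
    ENNReal.ofReal (Real.exp (q X u) + Real.exp (-q X u)) with hF
  have hFm : Measurable fun p : EuclideanSpace ℝ (Fin d × Fin n) × EuclideanSpace ℝ (Fin d) =>
      F p.1 p.2 := by
    have := hqc.measurable
    simp only [hF]
    fun_prop
  set Z : EuclideanSpace ℝ (Fin d × Fin n) → ℝ≥0∞ := fun X =>
    ∫⁻ u in Metric.ball (0 : EuclideanSpace ℝ (Fin d)) (3 / 2), F X u with hZ
  have hZm : Measurable Z := hFm.lintegral_prod_right'
  set V := volume (Metric.ball (0 : EuclideanSpace ℝ (Fin d)) (1 / 2)) with hV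
  have hVtop : V ≠ ⊤ := measure_ball_lt_top.ne
  have hV0 : V ≠ 0 := (Metric.measure_ball_pos volume 0 (by norm_num)).ne'
  set D : ℝ := 2 * Real.exp (n * ε ^ 2 / 2) * 3 ^ d with hD
  have hD0 : 0 < D := by positivity
  have hFint : ∀ u ∈ Metric.ball (0 : EuclideanSpace ℝ (Fin d)) (3 / 2),
      ∫⁻ X, F X u ∂γ ≤ ENNReal.ofReal (2 * Real.exp (n * ε ^ 2 / 2)) := by
    intro u hu
    rw [mem_ball_zero_iff] at hu
    have hu2 : u.ofLp ⬝ᵥ u.ofLp ≤ 9 / 4 := by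
      rw [dotProduct_self_ofLp]
      nlinarith [norm_nonneg u]
    have hu0 : 0 ≤ u.ofLp ⬝ᵥ u.ofLp := dotProduct_self_nonneg_real _
    have hmul : ∀ s : ℝ, |s| = t → |s| * (u.ofLp ⬝ᵥ u.ofLp) ≤ 1 / 4 := by
      intro s hs
      rw [hs]
      nlinarith
    have hexp : ∀ s : ℝ, |s| = t → ENNReal.ofReal (Real.exp (2 * s ^ 2 *
        ((u.ofLp ⬝ᵥ u.ofLp) ^ 2 * ∑ i, ∑ j, Q i j ^ 2))) ≤
        ENNReal.ofReal (Real.exp (n * ε ^ 2 / 2)) := by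
      intro s hs
      refine ENNReal.ofReal_le_ofReal (Real.exp_le_exp.2 ?_)
      rw [← sq_abs s, hs]
      calc 2 * t ^ 2 * ((u.ofLp ⬝ᵥ u.ofLp) ^ 2 * ∑ i, ∑ j, Q i j ^ 2)
          ≤ 2 * t ^ 2 * ((9 / 4) ^ 2 * n) := by gcongr
        _ = n * ε ^ 2 / 2 := by rw [ht]; ring
    have hsplit : ∀ X, F X u = ENNReal.ofReal (Real.exp (q X u)) +
        ENNReal.ofReal (Real.exp (-q X u)) := fun X =>
      ENNReal.ofReal_add (Real.exp_pos _).le (Real.exp_pos _).le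
    have hm : Measurable fun X => q X u :=
      (Continuous.comp (f := fun X => (X, u))
        (g := fun p : EuclideanSpace ℝ (Fin d × Fin n) × EuclideanSpace ℝ (Fin d) => q p.1 p.2)
        hqc (Continuous.prodMk_left u)).measurable
    simp only [hsplit]
    rw [lintegral_add_left (by fun_prop), two_mul, ENNReal.ofReal_add (by positivity) (by positivity)]
    refine add_le_add ?_ ?_
    · exact (lintegral_exp_transpose_quadratic_le hQ u.ofLp (hmul t (abs_of_pos ht0))).trans
        (hexp t (abs_of_pos ht0))
    · have := (lintegral_exp_transpose_quadratic_le (d := d) hQ u.ofLp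
        (hmul (-t) (by rw [abs_neg, abs_of_pos ht0]))).trans
        (hexp (-t) (by rw [abs_neg, abs_of_pos ht0]))
      simpa only [hq, neg_mul] using this
  have hball : volume (Metric.ball (0 : EuclideanSpace ℝ (Fin d)) (3 / 2)) =
      ENNReal.ofReal (3 ^ d) * V := by
    have := Measure.addHaar_ball_mul_of_pos (volume : Measure (EuclideanSpace ℝ (Fin d))) 0
      (show (0 : ℝ) < 3 by norm_num) (1 / 2)
    rw [finrank_euclideanSpace_fin] at this
    rw [← this]
    norm_num
  have hZint : ∫⁻ X, Z X ∂γ ≤ ENNReal.ofReal D * V := by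
    calc ∫⁻ X, Z X ∂γ = ∫⁻ u in Metric.ball (0 : EuclideanSpace ℝ (Fin d)) (3 / 2),
          ∫⁻ X, F X u ∂γ := lintegral_lintegral_swap hFm.aemeasurable
      _ ≤ ∫⁻ u in Metric.ball (0 : EuclideanSpace ℝ (Fin d)) (3 / 2),
          ENNReal.ofReal (2 * Real.exp (n * ε ^ 2 / 2)) :=
          setLIntegral_mono' measurableSet_ball hFint
      _ = ENNReal.ofReal D * V := by
          rw [setLIntegral_const, hball, ← mul_assoc, ← ENNReal.ofReal_mul (by positivity)]
  refine ⟨{X | Z X ≤ ENNReal.ofReal (D / δ) * V}, measurableSet_le hZm measurable_const, ?_, ?_⟩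
  · have hT0 : ENNReal.ofReal (D / δ) * V ≠ 0 :=
      mul_ne_zero (by simpa using div_pos hD0 hδ) hV0
    have hTtop : ENNReal.ofReal (D / δ) * V ≠ ⊤ := ENNReal.mul_ne_top ENNReal.ofReal_ne_top hVtop
    calc γ {X | Z X ≤ ENNReal.ofReal (D / δ) * V}ᶜ
        ≤ γ {X | ENNReal.ofReal (D / δ) * V ≤ Z X} :=
          measure_mono fun X hX => by
            simp only [Set.mem_compl_iff, Set.mem_ofPred_eq, not_le] at hX ⊢
            exact hX.le
      _ ≤ (∫⁻ X, Z X ∂γ) / (ENNReal.ofReal (D / δ) * V) :=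
          meas_ge_le_lintegral_div hZm.aemeasurable hT0 hTtop
      _ ≤ ENNReal.ofReal δ := by
          rw [ENNReal.div_le_iff hT0 hTtop, ← mul_assoc, ← ENNReal.ofReal_mul hδ.le,
            mul_div_cancel₀ _ hδ.ne']
          exact hZint
  · intro X hX u
    have hqX : Continuous fun u => q X u := Continuous.comp (f := fun u => (X, u))
      (g := fun p : EuclideanSpace ℝ (Fin d × Fin n) × EuclideanSpace ℝ (Fin d) => q p.1 p.2)
      hqc (Continuous.prodMk_right X)
    have hpar : ∀ v h, q X (v + h) + q X (v - h) = 2 * q X v + 2 * q X h := by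
      intro v h
      simp only [hq, WithLp.ofLp_add, WithLp.ofLp_sub, Matrix.mulVec_add, Matrix.mulVec_sub,
        dotProduct_add, add_dotProduct, sub_dotProduct, dotProduct_sub]
      ring
    have hhom : ∀ (s : ℝ) v, q X (s • v) = s ^ 2 * q X v := by
      intro s v
      simp only [hq, WithLp.ofLp_smul, Matrix.mulVec_smul, smul_dotProduct, dotProduct_smul,
        smul_eq_mul]
      ring
    have hX' : Z X ≤ ENNReal.ofReal (D / δ) * V := hX
    obtain ⟨S, hS, hbound⟩ := exists_quadratic_bound_of_lintegral_exp_le hd hqX hpar hhom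
      (div_nonneg hD0.le hδ.le) hX'
    -- Half of nε² is the moment exponent; the other half, by `hn`, absorbs the factor 4·3^d/δ.
    have hSle : 3 / 4 * S ≤ n * ε ^ 2 := by
      have h1 : 2 * (D / δ) ≤ Real.exp (n * ε ^ 2) := by
        calc 2 * (D / δ) = (4 * 3 ^ d / δ) * Real.exp (n * ε ^ 2 / 2) := by rw [hD]; ring
          _ ≤ Real.exp (n * ε ^ 2 / 2) * Real.exp (n * ε ^ 2 / 2) := by
              gcongr
              exact (four_mul_three_pow_div_le hd hδ hδ4).trans (Real.exp_le_exp.2 hn)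
          _ = Real.exp (n * ε ^ 2) := by rw [← Real.exp_add]; congr 1; ring
      exact Real.exp_le_exp.1 (hS.trans h1)
    have h2 := hbound u
    simp only [hq, abs_mul, abs_of_pos ht0, dotProduct_self_ofLp] at h2
    have h3 : S ≤ t * (6 * ε * n) := by rw [ht]; nlinarith
    have h4 : S * ‖u‖ ^ 2 ≤ t * (6 * ε * n) * ‖u‖ ^ 2 := by gcongr
    refine le_of_mul_le_mul_left ((h2.trans h4).trans_eq ?_) ht0
    ring

lemma one_le_log_two_mul_div {d : ℕ} (hd : 0 < d) {δ : ℝ} (hδ : 0 < δ) (hδ4 : δ < 1 / 4) :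
    1 ≤ Real.log (2 * d / δ) ∧ -Real.log δ ≤ Real.log (2 * d / δ) := by
  have hd1 : (1 : ℝ) ≤ d := by exact_mod_cast hd
  constructor
  · rw [Real.le_log_iff_exp_le (by positivity), le_div_iff₀ hδ]
    nlinarith [Real.exp_one_lt_d9, Real.exp_pos 1]
  · rw [← Real.log_inv]
    apply Real.log_le_log (by positivity)
    rw [inv_eq_one_div]
    gcongr
    linarith

/-- Reduces the norm estimates below to unit vectors. -/
lemma dotProduct_self_inv_sqrt_smul {c : Fin n → ℝ} (hc : 0 < c ⬝ᵥ c) :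
    ((√(c ⬝ᵥ c))⁻¹ • c) ⬝ᵥ ((√(c ⬝ᵥ c))⁻¹ • c) = 1 ∧
      ∀ X : Matrix (Fin d) (Fin n) ℝ, X *ᵥ ((√(c ⬝ᵥ c))⁻¹ • c) ⬝ᵥ X *ᵥ ((√(c ⬝ᵥ c))⁻¹ • c) =
        (c ⬝ᵥ c)⁻¹ * (X *ᵥ c ⬝ᵥ X *ᵥ c) := by
  have h : (√(c ⬝ᵥ c))⁻¹ * (√(c ⬝ᵥ c))⁻¹ = (c ⬝ᵥ c)⁻¹ := by
    rw [← mul_inv, Real.mul_self_sqrt hc.le]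
  refine ⟨?_, fun X => ?_⟩
  · rw [smul_dotProduct, dotProduct_smul, smul_eq_mul, smul_eq_mul, ← mul_assoc, h,
      inv_mul_cancel₀ hc.ne']
  · rw [Matrix.mulVec_smul, smul_dotProduct, dotProduct_smul, smul_eq_mul, smul_eq_mul,
      ← mul_assoc, h]

/-- With high probability the image of a fixed vector is short. -/
lemma measure_norm_mulVec_le (c : Fin n → ℝ) (hd : 0 < d) {ε δ : ℝ}
    (hδ : 0 < δ) (hδ4 : δ < 1 / 4)
    (hn : (d + 1) * Real.log (2 * d / δ) ≤ n * ε ^ 2 / 2) :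
    stdGaussian (EuclideanSpace ℝ (Fin d × Fin n))
      {X | (toMatrix X) *ᵥ c ⬝ᵥ (toMatrix X) *ᵥ c ≤ 4 * ε ^ 2 * n * (c ⬝ᵥ c)}ᶜ ≤
      ENNReal.ofReal δ := by
  rcases (dotProduct_self_nonneg_real c).eq_or_lt' with h0 | hpos
  · have : c = 0 := dotProduct_self_eq_zero.1 h0
    simp [this]
  · obtain ⟨hu, hX⟩ := dotProduct_self_inv_sqrt_smul (d := d) hpos
    have key := measure_mulVec_dotProduct_mulVec_tail_le (d := d) hu.le hu.le
      (t := 1 / 4) (by norm_num [abs_of_pos]) (-Real.log δ)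
    rw [neg_neg, Real.exp_log hδ] at key
    refine (measure_mono fun X hX' => ?_).trans key
    simp only [Set.mem_compl_iff, Set.mem_ofPred_eq, not_le] at hX' ⊢
    rw [hX, hu]
    have h1 : 4 * ε ^ 2 * n ≤ (c ⬝ᵥ c)⁻¹ * ((toMatrix X) *ᵥ c ⬝ᵥ (toMatrix X) *ᵥ c) := by
      rw [le_inv_mul_iff₀ hpos]
      linarith
    obtain ⟨h2, h3⟩ := one_le_log_two_mul_div hd hδ hδ4
    have hd0 : (1 : ℝ) ≤ d := by exact_mod_cast hd
    nlinarith

/-- With high probability the inner products with finitely many unit vectors are not much larger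
than their means. -/
lemma measure_mulVec_dotProduct_mulVec_le {m : ℕ} (hm : 0 < m) (a : Fin m → Fin n → ℝ)
    (ha : ∀ i, a i ⬝ᵥ a i ≤ 1) {y : Fin n → ℝ} (hy : y ⬝ᵥ y ≤ 1) {ε δ : ℝ} (hε : 0 < ε)
    (hε1 : ε < 1 / 10) (hδ : 0 < δ) (hdm : Real.log (m / δ) ≤ 2 * d * ε ^ 2) :
    stdGaussian (EuclideanSpace ℝ (Fin d × Fin n))
      {X | ∀ i, (toMatrix X) *ᵥ a i ⬝ᵥ (toMatrix X) *ᵥ y ≤ d * (a i ⬝ᵥ y + 5 * ε)}ᶜ ≤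
      ENNReal.ofReal δ := by
  have hm' : (0 : ℝ) < m := by exact_mod_cast hm
  have key : ∀ i, stdGaussian (EuclideanSpace ℝ (Fin d × Fin n))
      {X | d * (a i ⬝ᵥ y + 5 * ε) ≤ (toMatrix X) *ᵥ a i ⬝ᵥ (toMatrix X) *ᵥ y} ≤
      ENNReal.ofReal (δ / m) := by
    intro i
    -- With t = 2ε the threshold 2t²d + 2dε² = 10dε² is exactly t·d·5ε, while the deviation 2dε²
    -- pays for the union over m rows through `hdm`.
    have h := measure_mulVec_dotProduct_mulVec_tail_le (d := d) (ha i) hy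
      (t := 2 * ε) (by rw [abs_of_pos (by positivity)]; linarith) (2 * d * ε ^ 2)
    refine (measure_mono fun X hX => ?_).trans (h.trans (ENNReal.ofReal_le_ofReal ?_))
    · simp only [Set.mem_ofPred_eq] at hX ⊢
      nlinarith
    · rw [← Real.le_log_iff_exp_le (by positivity), ← inv_div, Real.log_inv]
      linarith
  have hsub : {X : EuclideanSpace ℝ (Fin d × Fin n) |
      ∀ i, (toMatrix X) *ᵥ a i ⬝ᵥ (toMatrix X) *ᵥ y ≤ d * (a i ⬝ᵥ y + 5 * ε)}ᶜ ⊆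
      ⋃ i, {X | d * (a i ⬝ᵥ y + 5 * ε) ≤ (toMatrix X) *ᵥ a i ⬝ᵥ (toMatrix X) *ᵥ y} := by
    intro X hX
    simp only [Set.mem_compl_iff, Set.mem_ofPred_eq, not_forall, not_le] at hX
    obtain ⟨i, hi⟩ := hX
    exact Set.mem_iUnion.2 ⟨i, hi.le⟩
  refine (measure_mono hsub).trans ((measure_iUnion_fintype_le _ _).trans
    ((Finset.sum_le_sum fun i _ => key i).trans_eq ?_))
  rw [Finset.sum_const, Finset.card_univ, Fintype.card_fin, nsmul_eq_mul,
    ← ENNReal.ofReal_natCast, ← ENNReal.ofReal_mul hm'.le, mul_div_cancel₀ _ hm'.ne']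

/-- With high probability the image of a fixed vector is not too short. -/
lemma measure_le_norm_mulVec (y : Fin n → ℝ) {δ : ℝ} (hδ : 0 < δ)
    (hd : -Real.log δ ≤ d / 16) :
    stdGaussian (EuclideanSpace ℝ (Fin d × Fin n))
      {X | d / 4 * (y ⬝ᵥ y) ≤ (toMatrix X) *ᵥ y ⬝ᵥ (toMatrix X) *ᵥ y}ᶜ ≤ ENNReal.ofReal δ := by
  rcases (dotProduct_self_nonneg_real y).eq_or_lt' with h0 | hpos
  · have : y = 0 := dotProduct_self_eq_zero.1 h0
    simp [this]
  · obtain ⟨hu, hX⟩ := dotProduct_self_inv_sqrt_smul (d := d) hpos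
    -- A negative t gives the lower tail. The budget is tight: d/8 + d/16 = (1/4)(d - d/4).
    have key := measure_mulVec_dotProduct_mulVec_tail_le (d := d) hu.le hu.le
      (t := -(1 / 4)) (by norm_num [abs_of_pos]) (-Real.log δ)
    rw [neg_neg, Real.exp_log hδ] at key
    refine (measure_mono fun X hX' => ?_).trans key
    simp only [Set.mem_compl_iff, Set.mem_ofPred_eq, not_le] at hX' ⊢
    rw [hX, hu]
    have h1 : (y ⬝ᵥ y)⁻¹ * ((toMatrix X) *ᵥ y ⬝ᵥ (toMatrix X) *ᵥ y) ≤ d / 4 := by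
      rw [inv_mul_le_iff₀ hpos]
      linarith
    linarith

end TrustRegion

/-! ### Deterministic ingredients. -/

namespace TrustRegion

variable {m n d : ℕ}

lemma abs_dotProduct_le_norm {ι : Type*} [Fintype ι] (u v : EuclideanSpace ℝ ι) :
    |u.ofLp ⬝ᵥ v.ofLp| ≤ ‖u‖ * ‖v‖ := by
  apply abs_le_of_sq_le_sq _ (by positivity)
  rw [mul_pow, ← dotProduct_self_ofLp, ← dotProduct_self_ofLp]
  exact dotProduct_sq_le _ _

lemma projModel_eq (P : Matrix (Fin d) (Fin n) ℝ) (Q : Matrix (Fin n) (Fin n) ℝ)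
    (c : EuclideanSpace ℝ (Fin n)) (u : EuclideanSpace ℝ (Fin d)) :
    projModel P Q c u = quadModel Q c (applyMat Pᵀ u) := by
  simp only [projModel, quadModel, applyMat]
  congr 1
  · rw [← Matrix.mulVec_mulVec, ← Matrix.mulVec_mulVec, Matrix.dotProduct_mulVec u.ofLp P,
      Matrix.mulVec_transpose]
  · rw [Matrix.mulVec_transpose, dotProduct_comm, Matrix.dotProduct_mulVec, dotProduct_comm]

lemma mul_transpose_mulVec_apply (A : Matrix (Fin m) (Fin n) ℝ) (P : Matrix (Fin d) (Fin n) ℝ)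
    (u : Fin d → ℝ) (i : Fin m) : ((A * Pᵀ) *ᵥ u) i = P *ᵥ A i ⬝ᵥ u := by
  rw [← Matrix.mulVec_mulVec, Matrix.mulVec_transpose, dotProduct_comm, Matrix.dotProduct_mulVec,
    dotProduct_comm]
  rfl

section SpectralNorm

variable {Q : Matrix (Fin n) (Fin n) ℝ} (hQ : ‖Matrix.toEuclideanCLM (𝕜 := ℝ) Q‖ = 1)
include hQ

lemma norm_toLp_mulVec_le (v : EuclideanSpace ℝ (Fin n)) : ‖WithLp.toLp 2 (Q *ᵥ v.ofLp)‖ ≤ ‖v‖ := by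
  have := (Matrix.toEuclideanCLM (𝕜 := ℝ) Q).le_opNorm v
  rw [hQ, one_mul] at this
  exact this

lemma abs_dotProduct_mulVec_le (v : Fin n → ℝ) : |v ⬝ᵥ Q *ᵥ v| ≤ v ⬝ᵥ v := by
  have h1 := abs_dotProduct_le_norm (WithLp.toLp 2 v) (WithLp.toLp 2 (Q *ᵥ v))
  have h2 := norm_toLp_mulVec_le hQ (WithLp.toLp 2 v)
  have h3 := dotProduct_self_ofLp (WithLp.toLp 2 v)
  simp only at h1 h2 h3
  rw [h3]
  nlinarith [norm_nonneg (WithLp.toLp 2 v)]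

/-- Each column is the image of a basis vector, hence has norm at most 1. -/
lemma sum_sq_entries_le : ∑ i, ∑ j, Q i j ^ 2 ≤ n := by
  rw [Finset.sum_comm]
  have : ∀ j, ∑ i, Q i j ^ 2 ≤ 1 := by
    intro j
    have h1 := norm_toLp_mulVec_le hQ (EuclideanSpace.single j 1)
    rw [PiLp.norm_single, norm_one] at h1
    have h2 := pow_le_one₀ (norm_nonneg _) h1 (n := 2)
    rw [EuclideanSpace.real_norm_sq_eq] at h2
    simpa using h2
  exact (Finset.sum_le_sum fun j _ => this j).trans_eq (by simp)

lemma abs_trace_le : |Q.trace| ≤ n := by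
  refine (Finset.abs_sum_le_sum_abs _ _).trans
    ((Finset.sum_le_sum (g := fun _ => (1 : ℝ)) fun j _ => ?_).trans_eq (by simp))
  simpa using abs_dotProduct_mulVec_le hQ (Pi.single j 1)

lemma pos_of_norm_toEuclideanCLM_eq_one : 0 < n := by
  rcases Nat.eq_zero_or_pos n with rfl | h
  · have : Matrix.toEuclideanCLM (𝕜 := ℝ) Q = 0 := Subsingleton.elim _ _
    rw [this, norm_zero] at hQ
    exact absurd hQ zero_ne_one
  · exact h

end SpectralNorm

/-! ### Fullness and slack points. -/

section Fullness

variable (A : Matrix (Fin m) (Fin n) ℝ) (b : Fin m → ℝ)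

lemma convex_feasibleSet (ρ : ℝ) : Convex ℝ (feasibleSet A b ρ) := by
  intro x hx y hy s t hs ht hst
  refine ⟨fun i => ?_, ?_⟩
  · simp only [WithLp.ofLp_add, WithLp.ofLp_smul, Matrix.mulVec_add, Matrix.mulVec_smul,
      Pi.add_apply, Pi.smul_apply, smul_eq_mul]
    have h1 := mul_le_mul_of_nonneg_left (hx.1 i) hs
    have h2 := mul_le_mul_of_nonneg_left (hy.1 i) ht
    have h3 : s * b i + t * b i = b i := by rw [← add_mul, hst, one_mul]
    linarith
  · have h1 := mul_le_mul_of_nonneg_left hx.2 hs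
    have h2 := mul_le_mul_of_nonneg_left hy.2 ht
    have h3 : s * ρ + t * ρ = ρ := by rw [← add_mul, hst, one_mul]
    refine (norm_add_le _ _).trans ?_
    rw [norm_smul, norm_smul, Real.norm_of_nonneg hs, Real.norm_of_nonneg ht]
    linarith

/-- The antipodal points x ± re are 2r apart and both lie in the unit ball; a unit vector e exists
because n > 0. -/
lemma radius_le_one (hn : 0 < n) {r : ℝ} (hr : 0 ≤ r) {x : EuclideanSpace ℝ (Fin n)}
    (h : Metric.closedBall x r ⊆ feasibleSet A b 1) : r ≤ 1 := by
  set e : EuclideanSpace ℝ (Fin n) := EuclideanSpace.single ⟨0, hn⟩ 1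
  have he : ‖e‖ = 1 := by simp [e]
  have h1 : ‖x + r • e‖ ≤ 1 := (h (by simp [norm_smul, he, abs_of_nonneg hr])).2
  have h2 : ‖x - r • e‖ ≤ 1 := (h (by simp [norm_smul, he, abs_of_nonneg hr])).2
  have h3 : ‖(2 * r) • e‖ ≤ 2 := by
    rw [show (2 * r) • e = (x + r • e) - (x - r • e) by module]
    exact (norm_sub_le _ _).trans (by linarith)
  rw [norm_smul, he, Real.norm_of_nonneg (by positivity)] at h3
  linarith

lemma fullness_pos_and_le_one (hn : 0 < n) (hspan : affineSpan ℝ (feasibleSet A b 1) = ⊤) :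
    0 < fullness (feasibleSet A b 1) ∧ fullness (feasibleSet A b 1) ≤ 1 := by
  obtain ⟨x, hx⟩ := (convex_feasibleSet A b 1).interior_nonempty_iff_affineSpan_eq_top.2 hspan
  obtain ⟨r, hr, hball⟩ := Metric.nhds_basis_closedBall.mem_iff.1 (mem_interior_iff_mem_nhds.1 hx)
  -- Boundedness matters: `sSup` of an unbounded set of reals is 0 by convention.
  have hb : ∀ s ∈ {r : ℝ | 0 ≤ r ∧ ∃ x, Metric.closedBall x r ⊆ feasibleSet A b 1}, s ≤ 1 :=
    fun s ⟨hs, y, hy⟩ => radius_le_one A b hn hs hy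
  have hmem : r ∈ {r : ℝ | 0 ≤ r ∧ ∃ x, Metric.closedBall x r ⊆ feasibleSet A b 1} :=
    ⟨le_of_lt hr, x, hball⟩
  exact ⟨lt_of_lt_of_le hr (le_csSup ⟨1, hb⟩ hmem), csSup_le ⟨r, hmem⟩ hb⟩

/-- A point of `S` with slack in every constraint, away from the origin. -/
lemma exists_slack_point (hA : ∀ i, ‖WithLp.toLp 2 (A i)‖ = 1) (hm : 0 < m) {η : ℝ} (hη : 0 < η)
    (hfull : 2 * η < fullness (feasibleSet A b 1)) :
    ∃ x : EuclideanSpace ℝ (Fin n), η ≤ ‖x‖ ∧ ‖x‖ ≤ 1 ∧ ∀ i, A i ⬝ᵥ x.ofLp + η ≤ b i := by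
  have hne : {r : ℝ | 0 ≤ r ∧ ∃ x, Metric.closedBall x r ⊆ feasibleSet A b 1}.Nonempty := by
    by_contra hcon
    rw [Set.not_nonempty_iff_eq_empty] at hcon
    rw [fullness, hcon, Real.sSup_empty] at hfull
    linarith
  obtain ⟨r, ⟨hr0, y, hy⟩, hr⟩ := exists_lt_of_lt_csSup hne hfull
  have hself : ∀ i, A i ⬝ᵥ A i = 1 := fun i => by
    have := dotProduct_self_ofLp (WithLp.toLp 2 (A i))
    rw [hA i] at this
    simpa using this
  set a : EuclideanSpace ℝ (Fin n) := WithLp.toLp 2 (A ⟨0, hm⟩) with ha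
  have ha1 : ‖a‖ = 1 := hA _
  have haa : a.ofLp ⬝ᵥ a.ofLp = 1 := hself _
  -- The sign makes a step of length η along a row increase |⟨a, y⟩|, which keeps the new point away
  -- from 0. As r > 2η, a ball of radius η around it still fits, and this is the slack.
  obtain ⟨s, hs, hsy⟩ : ∃ s : ℝ, |s| = 1 ∧ 0 ≤ s * (a.ofLp ⬝ᵥ y.ofLp) := by
    rcases le_total 0 (a.ofLp ⬝ᵥ y.ofLp) with h | h
    · exact ⟨1, by simp, by simpa using h⟩
    · exact ⟨-1, by simp, by linarith⟩
  have hss : s * s = 1 := by rw [← abs_mul_abs_self, hs, one_mul]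
  refine ⟨y + (s * η) • a, ?_, ?_, fun i => ?_⟩
  · have h1 := abs_dotProduct_le_norm a (y + (s * η) • a)
    rw [ha1, one_mul] at h1
    refine le_trans ?_ h1
    rw [WithLp.ofLp_add, WithLp.ofLp_smul, dotProduct_add, dotProduct_smul, haa, smul_eq_mul,
      mul_one]
    calc η ≤ s * (a.ofLp ⬝ᵥ y.ofLp + s * η) := by
          rw [mul_add, ← mul_assoc, hss]
          linarith
      _ ≤ |s * (a.ofLp ⬝ᵥ y.ofLp + s * η)| := le_abs_self _
      _ = _ := by rw [abs_mul, hs, one_mul]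
  · refine (hy ?_).2
    rw [mem_closedBall_iff_norm, add_sub_cancel_left, norm_smul, ha1, mul_one, Real.norm_eq_abs,
      abs_mul, hs, abs_of_pos hη]
    linarith
  · have h1 : y + (s * η) • a + η • WithLp.toLp 2 (A i) ∈ Metric.closedBall y r := by
      rw [mem_closedBall_iff_norm, add_assoc, add_sub_cancel_left]
      refine (norm_add_le _ _).trans ?_
      rw [norm_smul, norm_smul, ha1, hA, mul_one, mul_one, Real.norm_eq_abs, abs_mul, hs,
        Real.norm_of_nonneg hη.le, abs_of_pos hη]
      linarith
    have h2 : A i ⬝ᵥ (y + (s * η) • a + η • WithLp.toLp 2 (A i)).ofLp ≤ b i := (hy h1).1 i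
    rw [WithLp.ofLp_add, dotProduct_add, WithLp.ofLp_smul, dotProduct_smul, hself, smul_eq_mul,
      mul_one] at h2
    exact h2

end Fullness

/-- The comparison of the optimal values, for an objective close to `τ ‖u‖²`. -/
lemma lt_add_of_near_isotropic {f : EuclideanSpace ℝ (Fin d) → ℝ}
    {ε τ κ F : ℝ} (hε : 0 < ε) (hε1 : ε < 1 / 10) (hτ : |τ| ≤ 1) (hκ : 0 ≤ κ)
    (hF0 : 0 < F) (hF1 : F ≤ 1)
    (hf : ∀ u, |f u - τ * ‖u‖ ^ 2| ≤ 6 * ε * ‖u‖ ^ 2 + 2 * ε * κ * ‖u‖)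
    {u v : EuclideanSpace ℝ (Fin d)} (hv : ‖v‖ ≤ 1 + ε) (hu0 : f u ≤ f 0)
    (hu : F ≤ 10 * ε ∨ ∃ w : EuclideanSpace ℝ (Fin d), ‖w‖ = 1 - ε ∧ f u ≤ f w) :
    f u < f v + ε / F * (36 + 18 * κ) := by
  have hf0 : f 0 = 0 := by simpa using hf 0
  obtain ⟨hτ1, hτ2⟩ := abs_le.1 hτ
  have hN0 := norm_nonneg v
  have hN2 : ‖v‖ ^ 2 ≤ (1 + ε) ^ 2 := by gcongr
  have hN3 : (1 + ε) ^ 2 ≤ 121 / 100 := by nlinarith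
  have hlow : τ * ‖v‖ ^ 2 - 6 * ε * (121 / 100) - 2 * ε * κ * (11 / 10) ≤ f v := by
    have h1 := (abs_le.1 (hf v)).1
    have h2 : 6 * ε * ‖v‖ ^ 2 ≤ 6 * ε * (121 / 100) := by gcongr; linarith
    have h3 : 2 * ε * κ * ‖v‖ ≤ 2 * ε * κ * (11 / 10) := by gcongr; linarith
    linarith
  have hεκ : 0 ≤ ε * κ := by positivity
  rcases hu with hF | ⟨w, hw, huw⟩
  -- Small fullness: the allowed gap is at least 3.6 + 1.8κ, more than -f(v) can be.
  · have h1 : 1 / 10 * (36 + 18 * κ) ≤ ε / F * (36 + 18 * κ) := by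
      refine mul_le_mul_of_nonneg_right ?_ (by positivity)
      rw [le_div_iff₀ hF0]
      linarith
    have h2 : -(121 / 100) ≤ τ * ‖v‖ ^ 2 := by nlinarith [sq_nonneg ‖v‖]
    have h3 : ε * κ ≤ 1 / 10 * κ := by gcongr
    linarith
  · have h1 : ε * (36 + 18 * κ) ≤ ε / F * (36 + 18 * κ) := by
      gcongr
      rw [le_div_iff₀ hF0]
      nlinarith
    rcases le_total 0 τ with hτ0 | hτ0
    · have : 0 ≤ τ * ‖v‖ ^ 2 := by positivity
      nlinarith
    -- For τ ≤ 0 long vectors are favoured, so compare w of norm 1-ε with the extreme norm 1+ε.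
    · have h2 : τ * (1 + ε) ^ 2 ≤ τ * ‖v‖ ^ 2 := mul_le_mul_of_nonpos_left hN2 hτ0
      have h3 := (abs_le.1 (hf w)).2
      rw [hw] at h3
      have h4 : 6 * ε * (1 - ε) ^ 2 ≤ 6 * ε * 1 := by
        gcongr
        nlinarith
      have h5 : 2 * ε * κ * (1 - ε) ≤ 2 * ε * κ * 1 := by
        gcongr
        linarith
      have h6 : τ * (1 - ε) ^ 2 - τ * (1 + ε) ^ 2 ≤ 4 * ε := by nlinarith
      nlinarith

/-- The normalised image of a slack point is feasible for the projected constraints. -/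
lemma exists_norm_eq_feasible {X : Matrix (Fin d) (Fin n) ℝ} {A : Matrix (Fin m) (Fin n) ℝ}
    {b : Fin m → ℝ} (hb : ∀ i, 0 ≤ b i) {ε : ℝ} (hε : 0 < ε) (hε1 : ε < 1 / 10) (hd : 0 < d)
    (hdn : (d : ℝ) ≤ n * ε ^ 2 / 2) {x : EuclideanSpace ℝ (Fin n)} (hx : 5 * ε ≤ ‖x‖)
    (hC : ∀ i, X *ᵥ A i ⬝ᵥ X *ᵥ x.ofLp ≤ d * b i)
    (hD : d / 4 * (x.ofLp ⬝ᵥ x.ofLp) ≤ X *ᵥ x.ofLp ⬝ᵥ X *ᵥ x.ofLp) :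
    ∃ w : EuclideanSpace ℝ (Fin d), ‖w‖ = 1 - ε ∧ ∀ i, X *ᵥ A i ⬝ᵥ w.ofLp ≤ √n * b i := by
  set z : EuclideanSpace ℝ (Fin d) := WithLp.toLp 2 (X *ᵥ x.ofLp) with hz
  have hd' : (0 : ℝ) < d := by exact_mod_cast hd
  have hzz : X *ᵥ x.ofLp ⬝ᵥ X *ᵥ x.ofLp = ‖z‖ ^ 2 := dotProduct_self_ofLp z
  rw [hzz, dotProduct_self_ofLp] at hD
  have hx2 : 25 * ε ^ 2 ≤ ‖x‖ ^ 2 := by nlinarith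
  have hz2 : d / 4 * (25 * ε ^ 2) ≤ ‖z‖ ^ 2 := le_trans (by gcongr) hD
  have hz0 : 0 < ‖z‖ := by
    have : 0 < ‖z‖ ^ 2 := lt_of_lt_of_le (by positivity) hz2
    exact (norm_nonneg z).lt_of_ne fun h => by simp [← h] at this
  -- From n ≥ 2d/ε² and ‖z‖² ≥ 25dε²/4 follows n‖z‖² ≥ 25d²/2. Together with b ≥ 0, this lets
  -- normalisation turn the bound d·bᵢ into √n·bᵢ.
  have hdz : d ≤ √n * ‖z‖ := by
    apply le_of_sq_le_sq _ (by positivity)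
    rw [mul_pow, Real.sq_sqrt (Nat.cast_nonneg n)]
    have := mul_le_mul_of_nonneg_left hz2 (Nat.cast_nonneg (α := ℝ) n)
    nlinarith
  refine ⟨((1 - ε) / ‖z‖) • z, ?_, fun i => ?_⟩
  · rw [norm_smul, Real.norm_of_nonneg (div_nonneg (by linarith) hz0.le),
      div_mul_cancel₀ _ hz0.ne']
  · rw [WithLp.ofLp_smul, dotProduct_smul, smul_eq_mul, div_mul_eq_mul_div, div_le_iff₀ hz0]
    calc (1 - ε) * (X *ᵥ A i ⬝ᵥ z.ofLp) ≤ (1 - ε) * (d * b i) :=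
          mul_le_mul_of_nonneg_left (hC i) (by linarith)
      _ ≤ 1 * (√n * ‖z‖ * b i) := by
          have := hb i
          gcongr
          linarith
      _ = _ := by ring

end TrustRegion

/-! ### The law of the projection and the good event. -/

namespace TrustRegion

variable {m n d : ℕ}

/-- The rescaled entries of a Gaussian matrix, as a vector. -/
noncomputable def rescaledVec (P : Matrix (Fin d) (Fin n) ℝ) :
    EuclideanSpace ℝ (Fin d × Fin n) :=
  WithLp.toLp 2 fun p => √n * P p.1 p.2

lemma toMatrix_rescaledVec_mulVec (P : Matrix (Fin d) (Fin n) ℝ) (v : Fin n → ℝ) :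
    toMatrix (rescaledVec P) *ᵥ v = √n • (P *ᵥ v) := by
  rw [← Matrix.smul_mulVec]
  rfl

lemma toMatrix_rescaledVec_transpose_mulVec (P : Matrix (Fin d) (Fin n) ℝ) (v : Fin d → ℝ) :
    (toMatrix (rescaledVec P))ᵀ *ᵥ v = √n • (Pᵀ *ᵥ v) := by
  rw [← Matrix.smul_mulVec]
  rfl

section Law

variable {Ω : Type*} [MeasurableSpace Ω] {μ : Measure Ω}
  {P : Ω → Matrix (Fin d) (Fin n) ℝ}

lemma IsGaussianMatrix.hasLaw_rescaledVec (hP : IsGaussianMatrix μ P) (hn : 0 < n) :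
    HasLaw (fun ω => rescaledVec (P ω)) (stdGaussian (EuclideanSpace ℝ (Fin d × Fin n))) μ := by
  have hn' : (n : ℝ≥0) ≠ 0 := by exact_mod_cast hn.ne'
  have h1 : ∀ p : Fin d × Fin n,
      HasLaw (fun ω => √n * P ω p.1 p.2) (gaussianReal 0 1) μ := by
    intro p
    have := gaussianReal_const_mul (hP.1 p.1 p.2) (√n)
    convert this using 2
    · simp
    · ext
      simp [Real.sq_sqrt, hn.ne']
  have h2 : iIndepFun (fun (p : Fin d × Fin n) ω => √n * P ω p.1 p.2) μ :=
    hP.2.comp (fun _ x => √n * x) fun _ => measurable_const_mul _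
  have h3 := h2.hasLaw_pi h1
  have h4 : HasLaw (WithLp.toLp 2) (stdGaussian (EuclideanSpace ℝ (Fin d × Fin n)))
      (Measure.pi fun _ : Fin d × Fin n => gaussianReal 0 1) :=
    ⟨by fun_prop, map_pi_eq_stdGaussian⟩
  exact h4.comp h3

lemma isOpenPosMeasure_stdGaussian (ι : Type*) [Fintype ι] :
    (stdGaussian (EuclideanSpace ℝ ι)).IsOpenPosMeasure := by
  have : (gaussianReal 0 1).IsOpenPosMeasure :=
    (gaussianReal_absolutelyContinuous' 0 one_ne_zero).isOpenPosMeasure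
  rw [← map_pi_eq_stdGaussian]
  exact (PiLp.continuous_toLp 2 _).isOpenPosMeasure_map (WithLp.toLp_surjective 2)

/-- If the projected problem is feasible almost surely, then the origin is feasible. -/
lemma IsGaussianMatrix.nonneg_of_ae_nonempty (hP : IsGaussianMatrix μ P) (hn : 0 < n)
    {A : Matrix (Fin m) (Fin n) ℝ} {b : Fin m → ℝ} {ε : ℝ} (hε : 0 < ε)
    (hfeas : ∀ᵐ ω ∂μ, (projMinus A b ε (P ω)).Nonempty) (i : Fin m) : 0 ≤ b i := by
  by_contra! hbi
  have hn' : (0 : ℝ) < n := by exact_mod_cast hn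
  have := isOpenPosMeasure_stdGaussian (Fin d × Fin n)
  have hlaw := hP.hasLaw_rescaledVec hn
  -- A neighbourhood of the zero matrix where ‖P Aᵢ‖ < |bᵢ|: by Cauchy-Schwarz no u in the unit ball
  -- reaches the negative level bᵢ. It has positive Gaussian measure, contradicting feasibility.
  set U : Set (EuclideanSpace ℝ (Fin d × Fin n)) :=
    {X | toMatrix X *ᵥ A i ⬝ᵥ toMatrix X *ᵥ A i < n * b i ^ 2} with hU
  have hcont : Continuous fun X : EuclideanSpace ℝ (Fin d × Fin n) =>
      toMatrix X *ᵥ A i ⬝ᵥ toMatrix X *ᵥ A i :=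
    (continuous_toMatrix.matrix_mulVec continuous_const).dotProduct
      (continuous_toMatrix.matrix_mulVec continuous_const)
  have hUo : IsOpen U := isOpen_lt hcont continuous_const
  have hU0 : (0 : EuclideanSpace ℝ (Fin d × Fin n)) ∈ U := by
    have h0 : toMatrix (0 : EuclideanSpace ℝ (Fin d × Fin n)) = 0 := rfl
    have : 0 < n * b i ^ 2 := by have := sq_pos_of_neg hbi; positivity
    simpa [hU, h0] using this
  have hpos := hUo.measure_pos (stdGaussian (EuclideanSpace ℝ (Fin d × Fin n))) ⟨0, hU0⟩
  rw [← hlaw.map_eq, Measure.map_apply_of_aemeasurable hlaw.aemeasurable hUo.measurableSet] at hpos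
  obtain ⟨ω, hω, hωf⟩ : ∃ ω, ω ∈ (fun ω => rescaledVec (P ω)) ⁻¹' U ∧
      (projMinus A b ε (P ω)).Nonempty := by
    by_contra! hcon
    exact hpos.ne' (measure_mono_null (fun ω hω => Set.not_nonempty_iff_eq_empty.2 (hcon ω hω))
      (ae_iff.1 hfeas))
  obtain ⟨u, hu, hu1⟩ := hωf
  have h1 := hu i
  rw [mul_transpose_mulVec_apply] at h1
  simp only [hU, Set.mem_preimage, Set.mem_ofPred_eq, toMatrix_rescaledVec_mulVec, smul_dotProduct,
    dotProduct_smul, smul_eq_mul] at hω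
  rw [← mul_assoc, Real.mul_self_sqrt hn'.le] at hω
  have h2 := lt_of_mul_lt_mul_left hω hn'.le
  have h3 := dotProduct_sq_le (P ω *ᵥ A i) u.ofLp
  rw [dotProduct_self_ofLp u] at h3
  have h4 : ‖u‖ ^ 2 ≤ 1 := pow_le_one₀ (norm_nonneg u) (by linarith)
  have h5 := dotProduct_self_nonneg_real (P ω *ᵥ A i)
  nlinarith

end Law

/-- The high-probability event on which the two projected problems are comparable. -/
lemma exists_measurableSet_good (A : Matrix (Fin m) (Fin n) ℝ) (b : Fin m → ℝ)
    {Q : Matrix (Fin n) (Fin n) ℝ} (c : EuclideanSpace ℝ (Fin n)) {ε δ : ℝ}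
    (hA : ∀ i, ‖WithLp.toLp 2 (A i)‖ = 1)
    (hQ : ‖Matrix.toEuclideanCLM (𝕜 := ℝ) Q‖ = 1) (hb : ∀ i, 0 ≤ b i)
    (hd : 0 < d) (hε : 0 < ε) (hε1 : ε < 1 / 10) (hδ : 0 < δ) (hδ4 : δ < 1 / 4)
    (hdm : Real.log (m / δ) ≤ 2 * d * ε ^ 2)
    (hn : (d + 1) * Real.log (2 * d / δ) ≤ n * ε ^ 2 / 2) :
    ∃ G : Set (EuclideanSpace ℝ (Fin d × Fin n)), MeasurableSet G ∧
      stdGaussian (EuclideanSpace ℝ (Fin d × Fin n)) Gᶜ ≤ ENNReal.ofReal (4 * δ) ∧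
      ∀ X ∈ G,
        (∀ u : EuclideanSpace ℝ (Fin d),
          |(toMatrix X)ᵀ *ᵥ u.ofLp ⬝ᵥ Q *ᵥ ((toMatrix X)ᵀ *ᵥ u.ofLp) - ‖u‖ ^ 2 * Q.trace| ≤
            6 * ε * n * ‖u‖ ^ 2) ∧
        (toMatrix X) *ᵥ c.ofLp ⬝ᵥ (toMatrix X) *ᵥ c.ofLp ≤ 4 * ε ^ 2 * n * ‖c‖ ^ 2 ∧
        (fullness (feasibleSet A b 1) ≤ 10 * ε ∨ ∃ w : EuclideanSpace ℝ (Fin d),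
          ‖w‖ = 1 - ε ∧ ∀ i, toMatrix X *ᵥ A i ⬝ᵥ w.ofLp ≤ √n * b i) := by
  obtain ⟨G₁, hG₁m, hG₁, hG₁X⟩ := exists_measurableSet_quadratic_concentration
    (abs_dotProduct_mulVec_le hQ) (sum_sq_entries_le hQ) hd hε hε1 hδ hδ4 hn
  have hG₂ := measure_norm_mulVec_le c.ofLp hd hδ hδ4 hn
  rw [dotProduct_self_ofLp] at hG₂
  set G₂ : Set (EuclideanSpace ℝ (Fin d × Fin n)) := {X | (toMatrix X) *ᵥ c.ofLp ⬝ᵥ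
    (toMatrix X) *ᵥ c.ofLp ≤ 4 * ε ^ 2 * n * ‖c‖ ^ 2} with hG₂def
  have hG₂m : MeasurableSet G₂ :=
    measurableSet_le (measurable_mulVec_dotProduct_mulVec _ _) measurable_const
  have hd1 : (1 : ℝ) ≤ d := by exact_mod_cast hd
  have hdn : (d : ℝ) ≤ n * ε ^ 2 / 2 := by
    have := (one_le_log_two_mul_div hd hδ hδ4).1
    nlinarith
  obtain ⟨G₃, hG₃m, hG₃, hG₃X⟩ : ∃ G : Set (EuclideanSpace ℝ (Fin d × Fin n)), MeasurableSet G ∧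
      stdGaussian (EuclideanSpace ℝ (Fin d × Fin n)) Gᶜ ≤ ENNReal.ofReal (2 * δ) ∧
      ∀ X ∈ G, (fullness (feasibleSet A b 1) ≤ 10 * ε ∨ ∃ w : EuclideanSpace ℝ (Fin d),
          ‖w‖ = 1 - ε ∧ ∀ i, toMatrix X *ᵥ A i ⬝ᵥ w.ofLp ≤ √n * b i) := by
    rcases le_or_gt (fullness (feasibleSet A b 1)) (10 * ε) with hF | hF
    · exact ⟨Set.univ, MeasurableSet.univ, by simp, fun X _ => Or.inl hF⟩
    -- Without rows there is no direction for the slack point, but any vector of norm 1-ε will do.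
    rcases Nat.eq_zero_or_pos m with rfl | hm
    · refine ⟨Set.univ, MeasurableSet.univ, by simp, fun X _ => Or.inr
        ⟨EuclideanSpace.single ⟨0, hd⟩ (1 - ε), ?_, fun i => i.elim0⟩⟩
      rw [PiLp.norm_single, Real.norm_of_nonneg (by linarith)]
    obtain ⟨x, hx, hx1, hxA⟩ := exists_slack_point A b hA hm (η := 5 * ε) (by positivity)
      (by linarith)
    have hm1 : (1 : ℝ) ≤ m := by exact_mod_cast hm
    have hself : ∀ i, A i ⬝ᵥ A i ≤ 1 := fun i => by
      have := dotProduct_self_ofLp (WithLp.toLp 2 (A i))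
      rw [hA i, one_pow] at this
      exact this.le
    have hxx : x.ofLp ⬝ᵥ x.ofLp ≤ 1 := by
      rw [dotProduct_self_ofLp]
      exact pow_le_one₀ (norm_nonneg x) hx1
    -- Since ε² ≤ 1/100, `hdm` gives at most d/50.
    have hlog : -Real.log δ ≤ d / 16 := by
      have h1 : -Real.log δ ≤ Real.log (m / δ) := by
        rw [Real.log_div (by positivity) hδ.ne']
        linarith [Real.log_nonneg hm1]
      have h2 : ε ^ 2 ≤ 1 / 100 := by nlinarith
      nlinarith
    have hC := measure_mulVec_dotProduct_mulVec_le (d := d) hm A hself hxx hε hε1 hδ hdm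
    have hD := measure_le_norm_mulVec (d := d) x.ofLp hδ hlog
    refine ⟨{X | ∀ i, (toMatrix X) *ᵥ A i ⬝ᵥ (toMatrix X) *ᵥ x.ofLp ≤
      d * (A i ⬝ᵥ x.ofLp + 5 * ε)} ∩ {X | d / 4 * (x.ofLp ⬝ᵥ x.ofLp) ≤
        (toMatrix X) *ᵥ x.ofLp ⬝ᵥ (toMatrix X) *ᵥ x.ofLp}, ?_, ?_, ?_⟩
    · refine MeasurableSet.inter ?_ ?_
      · rw [Set.ofPred_forall]
        exact MeasurableSet.iInter fun i =>
          measurableSet_le (measurable_mulVec_dotProduct_mulVec _ _) measurable_const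
      · exact measurableSet_le measurable_const (measurable_mulVec_dotProduct_mulVec _ _)
    · rw [Set.compl_inter, two_mul, ENNReal.ofReal_add hδ.le hδ.le]
      exact (measure_union_le _ _).trans (add_le_add hC hD)
    · rintro X ⟨hX1, hX2⟩
      refine Or.inr (exists_norm_eq_feasible hb hε hε1 hd hdn hx (fun i => (hX1 i).trans ?_) hX2)
      have := hxA i
      gcongr
  refine ⟨G₁ ∩ G₂ ∩ G₃, (hG₁m.inter hG₂m).inter hG₃m, ?_, fun X hX =>
    ⟨hG₁X X hX.1.1, hX.1.2, hG₃X X hX.2⟩⟩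
  rw [Set.compl_inter, Set.compl_inter, show 4 * δ = δ + δ + 2 * δ by ring,
    ENNReal.ofReal_add (by positivity) (by positivity), ENNReal.ofReal_add hδ.le hδ.le]
  exact (measure_union_le _ _).trans (add_le_add ((measure_union_le _ _).trans
    (add_le_add hG₁ hG₂)) hG₃)

/-- On the good event the objective of the projected problems is close to a multiple of `‖u‖²`. -/
lemma abs_quadModel_applyMat_sub_le {P : Matrix (Fin d) (Fin n) ℝ} {Q : Matrix (Fin n) (Fin n) ℝ}
    {c : EuclideanSpace ℝ (Fin n)} {ε : ℝ} (hε : 0 < ε) (hn : 0 < n)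
    (h1 : ∀ u : EuclideanSpace ℝ (Fin d),
      |(toMatrix (rescaledVec P))ᵀ *ᵥ u.ofLp ⬝ᵥ Q *ᵥ ((toMatrix (rescaledVec P))ᵀ *ᵥ u.ofLp) -
        ‖u‖ ^ 2 * Q.trace| ≤ 6 * ε * n * ‖u‖ ^ 2)
    (h2 : (toMatrix (rescaledVec P)) *ᵥ c.ofLp ⬝ᵥ (toMatrix (rescaledVec P)) *ᵥ c.ofLp ≤
      4 * ε ^ 2 * n * ‖c‖ ^ 2) (u : EuclideanSpace ℝ (Fin d)) :
    |quadModel Q c (applyMat Pᵀ u) - Q.trace / n * ‖u‖ ^ 2| ≤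
      6 * ε * ‖u‖ ^ 2 + 2 * ε * ‖c‖ * ‖u‖ := by
  have hn' : (0 : ℝ) < n := by exact_mod_cast hn
  have h3 := h1 u
  simp only [toMatrix_rescaledVec_transpose_mulVec, toMatrix_rescaledVec_mulVec,
    Matrix.mulVec_smul, smul_dotProduct, dotProduct_smul, smul_eq_mul, ← mul_assoc,
    Real.mul_self_sqrt hn'.le] at h2 h3
  have h4 : |Pᵀ *ᵥ u.ofLp ⬝ᵥ Q *ᵥ (Pᵀ *ᵥ u.ofLp) - Q.trace / n * ‖u‖ ^ 2| ≤ 6 * ε * ‖u‖ ^ 2 := by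
    refine le_of_mul_le_mul_left ?_ hn'
    have h6 : n * (Q.trace / n * ‖u‖ ^ 2) = ‖u‖ ^ 2 * Q.trace := by field_simp
    rw [← h6, ← mul_sub, abs_mul, abs_of_pos hn'] at h3
    exact h3.trans_eq (by ring)
  have h5 : |c.ofLp ⬝ᵥ Pᵀ *ᵥ u.ofLp| ≤ 2 * ε * ‖c‖ * ‖u‖ := by
    rw [Matrix.dotProduct_mulVec, Matrix.vecMul_transpose]
    apply abs_le_of_sq_le_sq _ (by positivity)
    refine (dotProduct_sq_le _ _).trans ?_
    rw [dotProduct_self_ofLp u, mul_pow]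
    gcongr
    refine le_of_mul_le_mul_left ?_ hn'
    linarith
  have : quadModel Q c (applyMat Pᵀ u) - Q.trace / n * ‖u‖ ^ 2 =
      (Pᵀ *ᵥ u.ofLp ⬝ᵥ Q *ᵥ (Pᵀ *ᵥ u.ofLp) - Q.trace / n * ‖u‖ ^ 2) +
        c.ofLp ⬝ᵥ Pᵀ *ᵥ u.ofLp := by
    simp only [quadModel, applyMat]
    ring
  rw [this]
  exact (abs_add_le _ _).trans (add_le_add h4 h5)

lemma projMinus_subset_projPlus {A : Matrix (Fin m) (Fin n) ℝ} {b : Fin m → ℝ} {ε : ℝ}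
    (hε : 0 < ε) (P : Matrix (Fin d) (Fin n) ℝ) : projMinus A b ε P ⊆ projPlus A b ε P :=
  fun _ hu => ⟨fun i => (hu.1 i).trans (by linarith), hu.2.trans (by linarith)⟩

end TrustRegion

/-! ### Assembly. -/

theorem mainTheorem7 :
    ∃ C₀ C₁ : ℝ, 1 < C₀ ∧ 1 / 4 < C₁ ∧
      ∀ (m n d : ℕ) (A : Matrix (Fin m) (Fin n) ℝ) (b : Fin m → ℝ)
        (Q : Matrix (Fin n) (Fin n) ℝ) (c : EuclideanSpace ℝ (Fin n)) (ε δ : ℝ)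
        (Ω : Type*) [MeasurableSpace Ω] (μ : Measure Ω) [IsProbabilityMeasure μ]
        (P : Ω → Matrix (Fin d) (Fin n) ℝ),
        (∀ i, ‖WithLp.toLp 2 (A i)‖ = 1) →
        ‖Matrix.toEuclideanCLM (𝕜 := ℝ) Q‖ = 1 →
        affineSpan ℝ (TrustRegion.feasibleSet A b 1) = ⊤ →
        0 < ε → ε < 1 / 10 → 0 < δ → δ < 1 →
        Real.log ((m : ℝ) / δ) / (C₀ * ε ^ 2) ≤ (d : ℝ) →
        ((d : ℝ) + 1) * Real.log (2 * (d : ℝ) / δ) / (C₁ * ε ^ 2) ≤ (n : ℝ) →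
        TrustRegion.IsGaussianMatrix μ P →
        (∀ᵐ ω ∂μ, (TrustRegion.projMinus A b ε (P ω)).Nonempty) →
        ∃ E : Set Ω, MeasurableSet E ∧ ENNReal.ofReal (1 - 4 * δ) ≤ μ E ∧
          ∀ ω ∈ E, ∀ uMinus uPlus : EuclideanSpace ℝ (Fin d),
            TrustRegion.IsOptimal (TrustRegion.projModel (P ω) Q c)
              (TrustRegion.projMinus A b ε (P ω)) uMinus →
            TrustRegion.IsOptimal (TrustRegion.projModel (P ω) Q c)
              (TrustRegion.projPlus A b ε (P ω)) uPlus →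
            TrustRegion.quadModel Q c (TrustRegion.applyMat (P ω)ᵀ uPlus) ≤
                TrustRegion.quadModel Q c (TrustRegion.applyMat (P ω)ᵀ uMinus) ∧
              TrustRegion.quadModel Q c (TrustRegion.applyMat (P ω)ᵀ uMinus) <
                TrustRegion.quadModel Q c (TrustRegion.applyMat (P ω)ᵀ uPlus) +
                  ε / TrustRegion.fullness (TrustRegion.feasibleSet A b 1) *
                    (36 + 18 * ‖c‖) := by
  -- These constants turn the dimension hypotheses into log(m/δ) ≤ 2dε² and (d+1)log(2d/δ) ≤ nε²/2.
  refine ⟨2, 1 / 2, by norm_num, by norm_num, ?_⟩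
  intro m n d A b Q c ε δ Ω _ μ _ P hA hQ hspan hε hε1 hδ hδ1 hdm hnd hP hfeas
  have hn : 0 < n := TrustRegion.pos_of_norm_toEuclideanCLM_eq_one hQ
  have hn' : (0 : ℝ) < n := by exact_mod_cast hn
  obtain ⟨hF0, hF1⟩ := TrustRegion.fullness_pos_and_le_one A b hn hspan
  have hb := hP.nonneg_of_ae_nonempty hn hε hfeas
  have hfst : ∀ ω, ∀ uMinus uPlus : EuclideanSpace ℝ (Fin d),
      TrustRegion.IsOptimal (TrustRegion.projModel (P ω) Q c)
        (TrustRegion.projMinus A b ε (P ω)) uMinus →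
      TrustRegion.IsOptimal (TrustRegion.projModel (P ω) Q c)
        (TrustRegion.projPlus A b ε (P ω)) uPlus →
      TrustRegion.quadModel Q c (TrustRegion.applyMat (P ω)ᵀ uPlus) ≤
        TrustRegion.quadModel Q c (TrustRegion.applyMat (P ω)ᵀ uMinus) := by
    intro ω u v hu hv
    rw [← TrustRegion.projModel_eq, ← TrustRegion.projModel_eq]
    exact hv.2 u (TrustRegion.projMinus_subset_projPlus hε _ hu.1)
  -- For d = 0 the two solutions coincide and the gap term is positive.
  rcases Nat.eq_zero_or_pos d with rfl | hd
  · refine ⟨Set.univ, MeasurableSet.univ, ?_, fun ω _ u v hu hv => ⟨hfst ω u v hu hv, ?_⟩⟩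
    · rw [measure_univ, ← ENNReal.ofReal_one]
      exact ENNReal.ofReal_le_ofReal (by linarith)
    · rw [Subsingleton.elim u v]
      exact lt_add_of_pos_right _ (by positivity)
  -- For δ ≥ 1/4 the required probability is at most 0, so the empty event works.
  rcases le_or_gt (1 / 4) δ with hδ4 | hδ4
  · refine ⟨∅, MeasurableSet.empty, ?_, fun ω hω => absurd hω (Set.notMem_empty ω)⟩
    rw [ENNReal.ofReal_of_nonpos (by linarith)]
    exact zero_le
  obtain ⟨G, hGm, hG, hGX⟩ := TrustRegion.exists_measurableSet_good (d := d) A b c hA hQ hb hd hε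
    hε1 hδ hδ4
    (by rw [div_le_iff₀ (by positivity)] at hdm; linarith)
    (by rw [div_le_iff₀ (by positivity)] at hnd; linarith)
  have hlaw := hP.hasLaw_rescaledVec hn
  -- The entries are only almost everywhere measurable, so the preimage of G is replaced by a
  -- measurable subset of the same measure.
  obtain ⟨E, hE, hEm, hEe⟩ :=
    (hlaw.aemeasurable.nullMeasurableSet_preimage hGm).exists_measurable_subset_ae_eq
  refine ⟨E, hEm, ?_, fun ω hω u v hu hv => ⟨hfst ω u v hu hv, ?_⟩⟩
  · rw [measure_congr hEe, ← Measure.map_apply_of_aemeasurable hlaw.aemeasurable hGm, hlaw.map_eq]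
    have h1 := prob_add_prob_compl (μ := stdGaussian (EuclideanSpace ℝ (Fin d × Fin n))) hGm
    rw [ENNReal.ofReal_sub _ (by positivity), ENNReal.ofReal_one, tsub_le_iff_right, ← h1]
    gcongr
  · obtain ⟨h1, h2, h3⟩ := hGX _ (hE hω)
    have hτ : |Q.trace / n| ≤ 1 := by
      rw [abs_div, abs_of_pos hn', div_le_one hn']
      exact TrustRegion.abs_trace_le hQ
    have hle : ∀ w ∈ TrustRegion.projMinus A b ε (P ω),
        TrustRegion.quadModel Q c (TrustRegion.applyMat (P ω)ᵀ u) ≤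
          TrustRegion.quadModel Q c (TrustRegion.applyMat (P ω)ᵀ w) := by
      intro w hw
      rw [← TrustRegion.projModel_eq, ← TrustRegion.projModel_eq]
      exact hu.2 w hw
    refine TrustRegion.lt_add_of_near_isotropic
      (f := fun u => TrustRegion.quadModel Q c (TrustRegion.applyMat (P ω)ᵀ u)) hε hε1 hτ
      (norm_nonneg c) hF0 hF1 (TrustRegion.abs_quadModel_applyMat_sub_le hε hn h1 h2) hv.1.2
      (hle 0 ⟨fun i => ?_, ?_⟩) (h3.imp_right fun ⟨w, hw, hwA⟩ => ⟨w, hw, hle w ⟨fun i => ?_, hw.le⟩⟩)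
    · simpa using hb i
    · rw [norm_zero]
      linarith
    · have := hwA i
      rw [TrustRegion.toMatrix_rescaledVec_mulVec, smul_dotProduct, smul_eq_mul] at this
      rw [TrustRegion.mul_transpose_mulVec_apply]
      exact le_of_mul_le_mul_left this (Real.sqrt_pos.2 hn')
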